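/- Computations are on a deterministic word RAM with word size $O(\log n)$ (all numbers computed are bounded by a fixed polynomial in the number $n$ of stored curves, respectively of vectors), and numbers in the input are fractions of polynomially bounded integers. The Orthogonal Vectors Hypothesis (OVH) states: for every $\varepsilon>0$ there is a $c>0$ such that no algorithm decides, for all sets $A,B\subseteq\{0,1\}^d$ with $|A|=|B|=N\ge 1$ and $d=\lceil c\log_2 N\rceil$, whether there are $a\in A$, $b\in B$ with $\langle a,b\rangle=0$, in time $O(N^{2-\varepsilon})$. For curves $P,Q:[0,1]\to\mathbb{R}$ let $d_F(P,Q)=\inf_{f,g}\max_{t\in[0,1]}|P(f(t))-Q(g(t))|$ be the continuous Fréchet distance, where $f,g$ range over the monotone (nondecreasing) surjections $[0,1]\to[0,1]$; the complexity of a polygonal curve is the number of its vertices. For $\gamma>1$, a $\gamma$-ANN preprocesses a set $\mathcal{P}$ of $n$ one-dimensional polygonal curves of complexity $m$ and a threshold $\delta>0$ into a data structure that answers every query by a one-dimensional polygonal curve $Q$ of complexity $k$, $2\le k\le m$, as follows: if some $P\in\mathcal{P}$ has $d_F(P,Q)\le\delta$, it returns a $P'\in\mathcal{P}$ with $d_F(P',Q)\le\gamma\delta$;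 if $d_F(P,Q)\ge\gamma\delta$ for all $P\in\mathcal{P}$, it returns "no"; otherwise it returns "no" or a $P\in\mathcal{P}$ with $d_F(P,Q)\le\gamma\delta$. **Theorem.** Assume OVH. For all $0<\varepsilon<2$, $\varepsilon'>0$ and $\beta>0$ there is a $c>0$ such that there is no $(3-\varepsilon)$-ANN for the continuous Fréchet distance storing $n$ one-dimensional curves of complexity $m$ and supporting query curves of complexity $k$, where $m=k=\lceil c\log_2 n\rceil$, with preprocessing time $O(n^{\beta})$ and query time $O(n^{1-\varepsilon'})$. This holds for every integer $D\ge1$, with $c$ not depending on $D$, even if the data structure only has to work when the vertices and $\delta$ are fractions $a/b$ of integers with $|a|\le(nm)^D$, $1\le b\le(nm)^D$. -/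

import Mathlib

namespace FrechetANN

/-! ### Word RAM

Words are natural numbers below a bound `W`; in every use below `W` is a fixed polynomial in the
input size, i.e. the word size is `O(log n)` bits. A machine has registers, a random access memory
and a random access read-only input. Programs are structured (sequence, branching, loops); every
elementary instruction and every test costs one step. -/

/-- Binary word instructions. -/
inductive BinOp where
  | add | sub | mul | div | mod | and | or | xor | shl | shr | lt | eq

/-- Subtraction is truncated at `0`; comparisons return `1` or `0`. -/
def BinOp.eval : BinOp → ℕ → ℕ → ℕ
  | .add, x, y => x + y
  | .sub, x, y => x - y
  | .mul, x, y => x * y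
  | .div, x, y => x / y
  | .mod, x, y => x % y
  | .and, x, y => x &&& y
  | .or, x, y => x ||| y
  | .xor, x, y => x ^^^ y
  | .shl, x, y => x <<< y
  | .shr, x, y => x >>> y
  | .lt, x, y => if x < y then 1 else 0
  | .eq, x, y => if x = y then 1 else 0

/-- Programs; the arguments `r`, `a`, `b` are names of registers. -/
inductive Prog where
  /-- do nothing -/
  | skip : Prog
  /-- `R[r] := v` -/
  | const (r v : ℕ) : Prog
  /-- `R[r] := R[a] o R[b]` -/
  | op (o : BinOp) (r a b : ℕ) : Prog
  /-- `R[r] := M[R[a]]` -/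
  | load (r a : ℕ) : Prog
  /-- `M[R[a]] := R[r]` -/
  | store (a r : ℕ) : Prog
  /-- `R[r] := input[R[a]]` -/
  | read (r a : ℕ) : Prog
  /-- first `p`, then `q` -/
  | seq (p q : Prog) : Prog
  /-- if `R[a] ≠ 0` then `p` else `q` -/
  | cond (a : ℕ) (p q : Prog) : Prog
  /-- as long as `R[a] ≠ 0`, run `p` -/
  | loop (a : ℕ) (p : Prog) : Prog

/-- Contents of the registers and of the memory. -/
structure State where
  reg : ℕ → ℕ
  mem : ℕ → ℕ

/-- All registers hold `0`, and the memory is `M`. -/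
def State.start (M : ℕ → ℕ) : State := ⟨fun _ => 0, M⟩

/-- Write the word `v` to the register `r`. -/
def State.setReg (s : State) (r v : ℕ) : State := ⟨Function.update s.reg r v, s.mem⟩

/-- Write the word `v` to the memory cell `a`. -/
def State.setMem (s : State) (a v : ℕ) : State := ⟨s.reg, Function.update s.mem a v⟩

/-- `Exec W inp p s t s'`: on the input `inp`, the program `p` started in the state `s` halts in
the state `s'` after exactly `t` steps, and every word that it computes is less than `W`.
(A program that produces a number `≥ W` gets stuck. Input positions after the end read as `0`.) -/
inductive Exec (W : ℕ) (inp : List ℕ) : Prog → State → ℕ → State → Prop where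
  | skip (s : State) : Exec W inp .skip s 1 s
  | const (s : State) (r v : ℕ) (h : v < W) : Exec W inp (.const r v) s 1 (s.setReg r v)
  | op (s : State) (o : BinOp) (r a b : ℕ) (h : o.eval (s.reg a) (s.reg b) < W) :
      Exec W inp (.op o r a b) s 1 (s.setReg r (o.eval (s.reg a) (s.reg b)))
  | load (s : State) (r a : ℕ) (h : s.mem (s.reg a) < W) :
      Exec W inp (.load r a) s 1 (s.setReg r (s.mem (s.reg a)))
  | store (s : State) (a r : ℕ) : Exec W inp (.store a r) s 1 (s.setMem (s.reg a) (s.reg r))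
  | read (s : State) (r a : ℕ) (h : inp.getD (s.reg a) 0 < W) :
      Exec W inp (.read r a) s 1 (s.setReg r (inp.getD (s.reg a) 0))
  | seq {p q : Prog} {s s' s'' : State} {t t' : ℕ}
      (hp : Exec W inp p s t s') (hq : Exec W inp q s' t' s'') :
      Exec W inp (.seq p q) s (t + t') s''
  | cond_true {a : ℕ} {p q : Prog} {s s' : State} {t : ℕ} (h : s.reg a ≠ 0)
      (hp : Exec W inp p s t s') : Exec W inp (.cond a p q) s (1 + t) s'
  | cond_false {a : ℕ} {p q : Prog} {s s' : State} {t : ℕ} (h : s.reg a = 0)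
      (hq : Exec W inp q s t s') : Exec W inp (.cond a p q) s (1 + t) s'
  | loop_true {a : ℕ} {p : Prog} {s s' s'' : State} {t t' : ℕ} (h : s.reg a ≠ 0)
      (hp : Exec W inp p s t s') (hl : Exec W inp (.loop a p) s' t' s'') :
      Exec W inp (.loop a p) s (1 + t + t') s''
  | loop_false {a : ℕ} {p : Prog} {s : State} (h : s.reg a = 0) :
      Exec W inp (.loop a p) s 1 s

/-- The number `c · log₂ n`, rounded up. -/
noncomputable def logSize (c : ℝ) (n : ℕ) : ℕ := ⌈c * Real.logb 2 n⌉₊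

/-! ### Orthogonal vectors -/

/-- `⟨a, b⟩ = 0` for 0-1-vectors. -/
def Orthogonal {d : ℕ} (a b : Fin d → Bool) : Prop := ∑ i, (a i).toNat * (b i).toNat = 0

/-- The coordinates of the vectors, one vector after the other, one coordinate per word. -/
def encodeVectors {N d : ℕ} (A : Fin N → Fin d → Bool) : List ℕ :=
  (List.ofFn fun i => List.ofFn fun j => (A i j).toNat).flatten

/-- The instance as given to the machine. -/
def ovInput {N d : ℕ} (A B : Fin N → Fin d → Bool) : List ℕ :=
  [N, d] ++ encodeVectors A ++ encodeVectors B

/-- The program `p` solves all instances of orthogonal vectors, consisting of two sets of `N ≥ 1`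
vectors each (listed in any order) in dimension `d = c log N`, in time `O(N ^ e)`. The answer is
yes iff register `0` is nonzero at the end. -/
def SolvesOV (c e : ℝ) (p : Prog) : Prop :=
  ∃ C K : ℕ, ∀ N d : ℕ, 1 ≤ N → d = logSize c N →
    ∀ A B : Fin N → Fin d → Bool, Function.Injective A → Function.Injective B →
      ∃ (t : ℕ) (s : State),
        Exec ((N + 2) ^ C) (ovInput A B) p (State.start fun _ => 0) t s ∧
        (t : ℝ) ≤ K * (N : ℝ) ^ e ∧
        (s.reg 0 ≠ 0 ↔ ∃ i j, Orthogonal (A i) (B j))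

/-- The Orthogonal Vectors Hypothesis. -/
def OVH : Prop := ∀ ε : ℝ, 0 < ε → ∃ c : ℝ, 0 < c ∧ ¬ ∃ p : Prog, SolvesOV c (2 - ε) p

/-! ### One-dimensional polygonal curves and the continuous Fréchet distance -/

/-- The polygonal curve with vertices `p 0, …, p (m - 1)`, parametrized over `[0, 1]` such that
each of the `m - 1` edges takes the same time. -/
noncomputable def polyCurve {m : ℕ} (p : Fin m → ℚ) (t : unitInterval) : ℝ :=
  let x : ℝ := (t : ℝ) * ((m : ℝ) - 1)
  let vertex : ℕ → ℝ := fun i => if h : i < m then (p ⟨i, h⟩ : ℝ) else 0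
  (1 - (x - ⌊x⌋₊)) * vertex ⌊x⌋₊ + (x - ⌊x⌋₊) * vertex (⌊x⌋₊ + 1)

/-- Monotone surjective functions from `[0, 1]` to `[0, 1]`. -/
def Reparam : Type := {f : unitInterval → unitInterval // Monotone f ∧ Function.Surjective f}

/-- The continuous Fréchet distance of two one-dimensional curves. -/
noncomputable def frechetDist (P Q : unitInterval → ℝ) : ℝ :=
  ⨅ fg : Reparam × Reparam, ⨆ t : unitInterval, |P (fg.1.1 t) - Q (fg.2.1 t)|

/-! ### The approximate near neighbor problem -/

/-- A rational number as given to the machine: sign, absolute value of the numerator,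
denominator. -/
def encodeRat (q : ℚ) : List ℕ := [if q < 0 then 1 else 0, q.num.natAbs, q.den]

/-- The sequence of the vertices of a curve. -/
def encodeCurve {m : ℕ} (p : Fin m → ℚ) : List ℕ :=
  (List.ofFn fun j => encodeRat (p j)).flatten

/-- The input of the preprocessing. -/
def annInput {n m : ℕ} (k : ℕ) (δ : ℚ) (P : Fin n → Fin m → ℚ) : List ℕ :=
  [n, m, k] ++ encodeRat δ ++ (List.ofFn fun i => encodeCurve (P i)).flatten

/-- `q = a / b` with integers `|a| ≤ B` and `1 ≤ b ≤ B`. -/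
def RatBounded (B : ℕ) (q : ℚ) : Prop := q.num.natAbs ≤ B ∧ q.den ≤ B

/-- `ans` (`none` for "no", `some j` for the curve `P j`) is a correct answer of a
`γ`-approximate near neighbor data structure with distance threshold `δ` to the query `Q`.
In the case not covered by the first two items, the third leaves the choice between "no" and any
curve at distance at most `γ δ`. -/
def CorrectAnswer {n m k : ℕ} (γ δ : ℝ) (P : Fin n → Fin m → ℚ) (Q : Fin k → ℚ)
    (ans : Option (Fin n)) : Prop :=
  ((∃ i, frechetDist (polyCurve (P i)) (polyCurve Q) ≤ δ) →
    ∃ j, ans = some j ∧ frechetDist (polyCurve (P j)) (polyCurve Q) ≤ γ * δ) ∧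
  ((∀ i, γ * δ ≤ frechetDist (polyCurve (P i)) (polyCurve Q)) → ans = none) ∧
  (∀ j, ans = some j → frechetDist (polyCurve (P j)) (polyCurve Q) ≤ γ * δ)

/-- The answer as a word: `0` for "no", and `j + 1` for the curve number `j`. -/
def encodeAnswer {n : ℕ} : Option (Fin n) → ℕ
  | none => 0
  | some j => j + 1

/-- There is a `γ`-approximate near neighbor data structure for the continuous Fréchet distance
that stores `n` one-dimensional curves of complexity `m n` and supports query curves of complexity
`k n`, with preprocessing time `O(Tpre n)` and query time `O(Tqry n)`. The vertices and the
threshold are fractions of integers of absolute value at most `(n m) ^ D`. A query is run on the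
memory that the preprocessing has left, with cleared registers and the query curve as input; its
answer is found in register `0`. -/
def HasANN (γ : ℝ) (m k : ℕ → ℕ) (D : ℕ) (Tpre Tqry : ℕ → ℝ) : Prop :=
  ∃ (pre qry : Prog) (C K : ℕ), ∀ n : ℕ, 1 ≤ n → 2 ≤ k n → k n ≤ m n →
    ∀ (δ : ℚ) (P : Fin n → Fin (m n) → ℚ), 0 < δ → RatBounded ((n * m n) ^ D) δ →
      Function.Injective P → (∀ i j, RatBounded ((n * m n) ^ D) (P i j)) →
      ∃ (t : ℕ) (s : State),
        Exec ((n + 2) ^ C) (annInput (k n) δ P) pre (State.start fun _ => 0) t s ∧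
        (t : ℝ) ≤ K * Tpre n ∧
        ∀ Q : Fin (k n) → ℚ, (∀ j, RatBounded ((n * m n) ^ D) (Q j)) →
          ∃ (t' : ℕ) (s' : State) (ans : Option (Fin n)),
            Exec ((n + 2) ^ C) (encodeCurve Q) qry (State.start s.mem) t' s' ∧
            (t' : ℝ) ≤ K * Tqry n ∧
            s'.reg 0 = encodeAnswer ans ∧
            CorrectAnswer γ (δ : ℝ) P Q ans

end FrechetANN

/-!
Why the theorem holds: a near neighbor data structure with approximation factor below `3` solves
orthogonal vectors in subquadratic time.

A vector is turned into a curve with two vertices per coordinate (`gadgetCurve`). At coordinate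
`i`, around the point `2 * i + 3`, a stored curve makes a step back, from `3` above to `3` below
this point for a one, and from `1` above to `1` below for a zero. A query curve steps back from `2`
above to `2` below for a zero, and it stays at the point for a one. If the vectors are orthogonal,
then corresponding vertices have distance at most `1`, and so have the curves
(`frechetDist_gadgetCurve_le`). If both vectors have a one at coordinate `i`, then the stored curve
moves from `3` above to `3` below a point that the query curve passes only once, from below to
above, and hence the distance is at least `3` (`le_frechetDist_gadgetCurve`). With the threshold
`1`, the answer to a query thus tells whether some stored vector is orthogonal to the query vector
(`CorrectAnswer.ne_none_iff`).

To beat the quadratic time even if the preprocessing takes time `n ^ β`, the first set of vectors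
is cut into groups of `n = 2 ^ r` vectors, where `n ^ M ≤ N < (2 * n) ^ M` for `M = ⌈β⌉`. For each
of the roughly `N / n` groups, the data structure is built in time `O(N)` and queried with all `N`
vectors of the second set. Together this takes time `O(N ^ 2 / n ^ η)` with `η = min ε' 1`, which is
`O(N ^ (2 - η / M))` (`reduction_time_le`). As `n` is a power of two and `c` is an integer, the
complexity `c * r` of the curves is easy to compute, and the vectors are padded with zeros to fill
the curves. Instances in which the groups would be too small are looked up in a table
(`exists_table`).

On the word RAM, the programs of the data structure are simulated (`exec_simulate`). Their input is
not written down: a constant-time subroutine computes each word of it from the orthogonal vectors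
instance (`readsInput_pre`, `readsInput_query`). Every query has to start from the memory that the
preprocessing has left, and there is no time to copy this memory. Therefore each simulated memory
cell has one copy for the preprocessing and one for the queries, and each copy carries a stamp that
tells which run has written it; a copy with an old stamp is ignored. Runs of programs are analysed
by rewriting with the weakest preconditions of the instructions (`Runs`).
-/

namespace FrechetANN

/-! ### Reasoning about programs -/

/-- The program `p`, started in `s`, halts, and the number of steps and the final state
satisfy `Q`. -/
def Runs (W : ℕ) (inp : List ℕ) (p : Prog) (s : State) (Q : ℕ → State → Prop) : Prop :=
  ∃ t s', Exec W inp p s t s' ∧ Q t s'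

theorem Runs.mono {W : ℕ} {inp : List ℕ} {p : Prog} {s : State} {Q Q' : ℕ → State → Prop}
    (h : Runs W inp p s Q) (hQ : ∀ t s', Q t s' → Q' t s') : Runs W inp p s Q' := by
  obtain ⟨t, s', he, hq⟩ := h
  exact ⟨t, s', he, hQ t s' hq⟩

section WeakestPreconditions

variable {W : ℕ} {inp : List ℕ} {s : State} {Q : ℕ → State → Prop}

theorem runs_skip : Runs W inp .skip s Q ↔ Q 1 s := by
  constructor
  · rintro ⟨t, s', he, hq⟩
    cases he
    exact hq
  · exact fun h => ⟨_, _, .skip s, h⟩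

theorem runs_const {r v : ℕ} :
    Runs W inp (.const r v) s Q ↔ v < W ∧ Q 1 (s.setReg r v) := by
  constructor
  · rintro ⟨t, s', he, hq⟩
    cases he with
    | const _ _ _ h => exact ⟨h, hq⟩
  · exact fun h => ⟨_, _, .const s r v h.1, h.2⟩

theorem runs_op {o : BinOp} {r a b : ℕ} :
    Runs W inp (.op o r a b) s Q ↔
      o.eval (s.reg a) (s.reg b) < W ∧ Q 1 (s.setReg r (o.eval (s.reg a) (s.reg b))) := by
  constructor
  · rintro ⟨t, s', he, hq⟩
    cases he with
    | op _ _ _ _ _ h => exact ⟨h, hq⟩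
  · exact fun h => ⟨_, _, .op s o r a b h.1, h.2⟩

theorem runs_load {r a : ℕ} :
    Runs W inp (.load r a) s Q ↔
      s.mem (s.reg a) < W ∧ Q 1 (s.setReg r (s.mem (s.reg a))) := by
  constructor
  · rintro ⟨t, s', he, hq⟩
    cases he with
    | load _ _ _ h => exact ⟨h, hq⟩
  · exact fun h => ⟨_, _, .load s r a h.1, h.2⟩

theorem runs_store {a r : ℕ} :
    Runs W inp (.store a r) s Q ↔ Q 1 (s.setMem (s.reg a) (s.reg r)) := by
  constructor
  · rintro ⟨t, s', he, hq⟩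
    cases he
    exact hq
  · exact fun h => ⟨_, _, .store s a r, h⟩

theorem runs_read {r a : ℕ} :
    Runs W inp (.read r a) s Q ↔
      inp.getD (s.reg a) 0 < W ∧ Q 1 (s.setReg r (inp.getD (s.reg a) 0)) := by
  constructor
  · rintro ⟨t, s', he, hq⟩
    cases he with
    | read _ _ _ h => exact ⟨h, hq⟩
  · exact fun h => ⟨_, _, .read s r a h.1, h.2⟩

theorem runs_seq {p q : Prog} :
    Runs W inp (.seq p q) s Q ↔
      Runs W inp p s fun t s' => Runs W inp q s' fun t' s'' => Q (t + t') s'' := by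
  constructor
  · rintro ⟨t, s', he, hq⟩
    cases he with
    | seq hp hq' => exact ⟨_, _, hp, _, _, hq', hq⟩
  · rintro ⟨t, s', he, t', s'', he', hq⟩
    exact ⟨_, _, .seq he he', hq⟩

theorem runs_cond {a : ℕ} {p q : Prog} :
    Runs W inp (.cond a p q) s Q ↔
      if s.reg a = 0 then Runs W inp q s fun t s' => Q (1 + t) s'
      else Runs W inp p s fun t s' => Q (1 + t) s' := by
  constructor
  · rintro ⟨t, s', he, hq⟩
    cases he with
    | cond_true h hp => rw [if_neg h]; exact ⟨_, _, hp, hq⟩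
    | cond_false h hp => rw [if_pos h]; exact ⟨_, _, hp, hq⟩
  · intro h
    split_ifs at h with h0
    · obtain ⟨t, s', he, hq⟩ := h
      exact ⟨_, _, .cond_false h0 he, hq⟩
    · obtain ⟨t, s', he, hq⟩ := h
      exact ⟨_, _, .cond_true h0 he, hq⟩

end WeakestPreconditions

/-- If every round of a loop takes at most `T` steps and lowers the index `k` of the invariant `I`
by one, then the loop halts within `k * (T + 1) + 1` steps. -/
theorem runs_loop {W : ℕ} {inp : List ℕ} {a : ℕ} {p : Prog} (I : ℕ → State → Prop) (T : ℕ)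
    (step : ∀ k s, I k s → s.reg a ≠ 0 →
      ∃ k', k = k' + 1 ∧ Runs W inp p s fun t s' => t ≤ T ∧ I k' s')
    {k : ℕ} {s : State} (h : I k s) :
    Runs W inp (.loop a p) s fun t s' => t ≤ k * (T + 1) + 1 ∧ s'.reg a = 0 ∧ ∃ k', I k' s' := by
  induction k generalizing s with
  | zero =>
    by_cases h0 : s.reg a = 0
    · exact ⟨1, s, .loop_false h0, by omega, h0, 0, h⟩
    · obtain ⟨k', hk, -⟩ := step _ _ h h0
      omega
  | succ k ih =>
    by_cases h0 : s.reg a = 0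
    · exact ⟨1, s, .loop_false h0, by omega, h0, _, h⟩
    · obtain ⟨k', hk, t, s', he, ht, hI⟩ := step _ _ h h0
      obtain rfl : k = k' := by omega
      obtain ⟨t', s'', he', ht', h0', hI'⟩ := ih hI
      refine ⟨_, _, .loop_true h0 he he', ?_, h0', hI'⟩
      rw [Nat.succ_mul]
      omega

/-- Sequential composition of a list of programs. -/
def block : List Prog → Prog
  | [] => .skip
  | p :: l => .seq p (block l)

theorem runs_block_nil {W : ℕ} {inp : List ℕ} {s : State} {Q : ℕ → State → Prop} :
    Runs W inp (block []) s Q ↔ Q 1 s := runs_skip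

theorem runs_block_cons {W : ℕ} {inp : List ℕ} {s : State} {Q : ℕ → State → Prop}
    {p : Prog} {l : List Prog} :
    Runs W inp (block (p :: l)) s Q ↔
      Runs W inp p s fun t s' => Runs W inp (block l) s' fun t' s'' => Q (t + t') s'' := runs_seq

theorem setReg_reg (s : State) (r v x : ℕ) :
    (s.setReg r v).reg x = if x = r then v else s.reg x := by
  simp [State.setReg, Function.update_apply]

theorem setReg_mem (s : State) (r v : ℕ) : (s.setReg r v).mem = s.mem := rfl

theorem setMem_reg (s : State) (a v : ℕ) : (s.setMem a v).reg = s.reg := rfl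

theorem setMem_mem (s : State) (a v x : ℕ) :
    (s.setMem a v).mem x = if x = a then v else s.mem x := by
  simp [State.setMem, Function.update_apply]

/-- Any property of finitely many bounded input words is decided in constant time, by a table of
all cases. -/
theorem exists_table (V T : ℕ) (F : (ℕ → ℕ) → Prop) :
    ∃ (p : Prog) (K : ℕ), ∀ (W : ℕ) (inp : List ℕ) (s : State), V + T + 1 < W →
      (∀ i, inp.getD i 0 < V) → Runs W inp p s fun t s' => t ≤ K ∧
        (s'.reg 0 ≠ 0 ↔ F fun i => if i < T then inp.getD i 0 else 0) := by
  induction T generalizing F with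
  | zero =>
    by_cases hF : F fun _ => 0
    · exact ⟨.const 0 1, 1, fun W inp s hW _ => by simp [runs_const, setReg_reg, hF]; omega⟩
    · exact ⟨.const 0 0, 1, fun W inp s hW _ => by simp [runs_const, setReg_reg, hF]; omega⟩
  | succ T ih =>
    -- one subtree for each value of the word at position `T`
    choose p K h using fun v => ih fun f => F (Function.update f T v)
    suffices H : ∀ V' ≤ V, ∃ (q : Prog) (K' : ℕ), ∀ (W : ℕ) (inp : List ℕ) (s : State),
        V + T + 2 < W → (∀ i, inp.getD i 0 < V) → inp.getD T 0 < V' →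
        Runs W inp q s fun t s' => t ≤ K' ∧
          (s'.reg 0 ≠ 0 ↔ F fun i => if i < T + 1 then inp.getD i 0 else 0) by
      obtain ⟨q, K', hq⟩ := H V le_rfl
      exact ⟨q, K', fun W inp s hW hV => hq W inp s (by omega) hV (hV T)⟩
    intro V'
    induction V' with
    | zero => exact fun _ => ⟨.skip, 0, fun W inp s _ _ h0 => by omega⟩
    | succ v ihv =>
      intro hv
      obtain ⟨q, K', hq⟩ := ihv (by omega)
      refine ⟨block [.const 1 v, .const 2 T, .read 2 2, .op .eq 1 1 2, .cond 1 (p v) q],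
        K v + K' + 6, fun W inp s hW hV hvT => ?_⟩
      simp only [runs_block_cons, runs_block_nil, runs_const, runs_read, runs_op, runs_cond,
        setReg_reg, BinOp.eval]
      have hT := hV T
      refine ⟨by omega, by omega, lt_of_lt_of_le hT (by omega), by split_ifs <;> omega, ?_⟩
      by_cases hvT' : v = inp.getD T 0
      · simp only [if_true, hvT'.symm, Nat.reduceEqDiff, if_false, one_ne_zero]
        refine (h v W inp _ (by omega) hV).mono fun t s' ⟨ht, hs⟩ => ⟨by omega, ?_⟩
        rw [hs]
        refine iff_of_eq (congrArg F (funext fun i => ?_))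
        rcases lt_trichotomy i T with hi | rfl | hi
        · simp [hi.ne, hi, Nat.lt_succ_of_lt hi]
        · simp [hvT']
        · simp [hi.ne', not_lt.2 hi.le, not_lt.2 (Nat.succ_le_of_lt hi)]
      · simp only [if_true, hvT', Nat.reduceEqDiff, if_false]
        exact (hq W inp _ hW hV (by omega)).mono fun t s' ⟨ht, hs⟩ => ⟨by omega, hs⟩

/-! ### Simulating a program with virtual input and stamped memory -/

/-- All registers named in the program are smaller than `R`. -/
def RegsLt (R : ℕ) : Prog → Prop
  | .skip => True
  | .const r _ => r < R
  | .op _ r a b => r < R ∧ a < R ∧ b < R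
  | .load r a => r < R ∧ a < R
  | .store a r => a < R ∧ r < R
  | .read r a => r < R ∧ a < R
  | .seq p q => RegsLt R p ∧ RegsLt R q
  | .cond a p q => a < R ∧ RegsLt R p ∧ RegsLt R q
  | .loop a p => a < R ∧ RegsLt R p

theorem RegsLt.mono {R R' : ℕ} (h : R ≤ R') {p : Prog} (hp : RegsLt R p) : RegsLt R' p := by
  induction p with
  | skip => trivial
  | const r v => exact lt_of_lt_of_le hp h
  | op o r a b => exact ⟨by have := hp.1; omega, by have := hp.2.1; omega, by have := hp.2.2; omega⟩
  | load r a => exact ⟨by have := hp.1; omega, by have := hp.2; omega⟩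
  | store a r => exact ⟨by have := hp.1; omega, by have := hp.2; omega⟩
  | read r a => exact ⟨by have := hp.1; omega, by have := hp.2; omega⟩
  | seq p q ihp ihq => exact ⟨ihp hp.1, ihq hp.2⟩
  | cond a p q ihp ihq => exact ⟨by have := hp.1; omega, ihp hp.2.1, ihq hp.2.2⟩
  | loop a p ih => exact ⟨by have := hp.1; omega, ih hp.2⟩

theorem exists_regsLt (p : Prog) : ∃ R, RegsLt R p := by
  induction p with
  | skip => exact ⟨0, trivial⟩
  | const r v => exact ⟨r + 1, Nat.lt_succ_self r⟩
  | op o r a b => exact ⟨r + a + b + 1, by omega, by omega, by omega⟩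
  | load r a => exact ⟨r + a + 1, by omega, by omega⟩
  | store a r => exact ⟨r + a + 1, by omega, by omega⟩
  | read r a => exact ⟨r + a + 1, by omega, by omega⟩
  | seq p q ihp ihq =>
    obtain ⟨R, hR⟩ := ihp
    obtain ⟨R', hR'⟩ := ihq
    exact ⟨R + R', hR.mono (by omega), hR'.mono (by omega)⟩
  | cond a p q ihp ihq =>
    obtain ⟨R, hR⟩ := ihp
    obtain ⟨R', hR'⟩ := ihq
    exact ⟨a + 1 + R + R', by omega, hR.mono (by omega), hR'.mono (by omega)⟩
  | loop a p ih =>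
    obtain ⟨R, hR⟩ := ih
    exact ⟨a + 1 + R, by omega, hR.mono (by omega)⟩

/-- Read the virtual memory cell with address `R[a]` into `R[r]`. A virtual cell `x` has a copy in
layer `up`, which is valid if its stamp is `R[13]`, and one in layer `low`, which is valid if its
stamp is `R[14]`; if neither is valid, then the cell holds `0`. In layer `l`, the stamp is stored
in the cell `6 * x + l` and the value in the cell `6 * x + l + 1`. -/
def virtualLoad (up low r a : ℕ) : Prog :=
  block [.const 2 6, .op .mul 1 a 2, .const 3 up, .op .add 2 1 3, .load 3 2, .op .eq 3 3 13,
    .const 4 1,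
    .cond 3 (block [.op .add 2 2 4, .load r 2])
      (block [.const 3 low, .op .add 2 1 3, .load 3 2, .op .eq 3 3 14,
        .cond 3 (block [.op .add 2 2 4, .load r 2]) (.const r 0)])]

/-- Write `R[r]` to the copy in layer `up` of the virtual memory cell with address `R[a]`, and
stamp this copy with `R[13]`. -/
def virtualStore (up a r : ℕ) : Prog :=
  block [.const 2 6, .op .mul 1 a 2, .const 3 up, .op .add 2 1 3, .store 2 13, .const 4 1,
    .op .add 2 2 4, .store 2 r]

/-- The program that simulates a given one. Register `r` becomes register `r + 20`, the memory is
virtual as in `virtualLoad`, and the program `rd` replaces the word in register `1` by the word in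
this position of the virtual input. The registers `1` to `6` are used for intermediate results. -/
def simulate (rd : Prog) (up low : ℕ) : Prog → Prog
  | .skip => .skip
  | .const r v => .const (r + 20) v
  | .op o r a b => .op o (r + 20) (a + 20) (b + 20)
  | .load r a => virtualLoad up low (r + 20) (a + 20)
  | .store a r => virtualStore up (a + 20) (r + 20)
  | .read r a => block [.const 1 0, .op .add 1 1 (a + 20), rd, .const 2 0, .op .add (r + 20) 1 2]
  | .seq p q => .seq (simulate rd up low p) (simulate rd up low q)
  | .cond a p q => .cond (a + 20) (simulate rd up low p) (simulate rd up low q)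
  | .loop a p => .loop (a + 20) (simulate rd up low p)

/-- The contents of the memory layer `l` where the stamp is `st`, and `base` elsewhere. -/
def layer (l st : ℕ) (base mem : ℕ → ℕ) (x : ℕ) : ℕ :=
  if mem (6 * x + l) = st then mem (6 * x + l + 1) else base x

/-- The state `s` is simulated by the state `σ`, where the simulation began in the state `σ₀`. -/
structure Simulates (W W' R up low : ℕ) (σ₀ s σ : State) : Prop where
  reg : ∀ r < R, σ.reg (r + 20) = s.reg r
  reg_lt : ∀ r, s.reg r < W
  control : ∀ r < 20, r = 0 ∨ 7 ≤ r → σ.reg r = σ₀.reg r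
  mem : ∀ x, s.mem x = layer up (σ₀.reg 13) (layer low (σ₀.reg 14) (fun _ => 0) σ₀.mem) σ.mem x
  frame : ∀ y, y % 6 ≠ up → y % 6 ≠ up + 1 → σ.mem y = σ₀.mem y
  mem_lt : ∀ y, σ.mem y < W'
  stamp : ∀ x, σ.mem (6 * x + up) = σ₀.mem (6 * x + up) ∨ σ.mem (6 * x + up) = σ₀.reg 13

/-- The program `rd` computes the words of the virtual input `vinp` in at most `κ` steps, in all
states with the same memory bound and control registers as `σ₀`. -/
def ReadsInput (W W' : ℕ) (inp vinp : List ℕ) (κ : ℕ) (rd : Prog) (σ₀ : State) : Prop :=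
  ∀ σ : State, (∀ r < 20, r = 0 ∨ 7 ≤ r → σ.reg r = σ₀.reg r) → σ.reg 1 < W →
    Runs W' inp rd σ fun t σ' => t ≤ κ ∧ σ'.reg 1 = vinp.getD (σ.reg 1) 0 ∧ σ'.mem = σ.mem ∧
      ∀ r, r = 0 ∨ 7 ≤ r → σ'.reg r = σ.reg r

section

variable {W W' R up low : ℕ} {inp vinp : List ℕ} {rd : Prog} {σ₀ s σ : State}

theorem Simulates.setReg (h : Simulates W W' R up low σ₀ s σ) {r v : ℕ} (hv : v < W)
    {σ' : State} (hmem : σ'.mem = σ.mem) (hr : σ'.reg (r + 20) = v)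
    (hreg : ∀ x, x = 0 ∨ 7 ≤ x → x ≠ r + 20 → σ'.reg x = σ.reg x) :
    Simulates W W' R up low σ₀ (s.setReg r v) σ' where
  reg x hx := by
    rw [setReg_reg]
    split_ifs with hxr
    · rw [hxr, hr]
    · rw [hreg _ (by omega) (by omega), h.reg x hx]
  reg_lt x := by
    rw [setReg_reg]
    split_ifs
    exacts [hv, h.reg_lt x]
  control x hx hx' := by rw [hreg x hx' (by omega), h.control x hx hx']
  mem := by rw [hmem]; exact h.mem
  frame := by rw [hmem]; exact h.frame
  mem_lt := by rw [hmem]; exact h.mem_lt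
  stamp := by rw [hmem]; exact h.stamp

theorem Simulates.setMem (h : Simulates W W' R up low σ₀ s σ) (hW : W ≤ W') (hup : up ≤ 4)
    (h13 : σ₀.reg 13 < W') {a v : ℕ} (hv : v < W) {σ' : State}
    (hmem : σ'.mem = fun y => if y = 6 * a + up + 1 then v else
      if y = 6 * a + up then σ₀.reg 13 else σ.mem y)
    (hreg : ∀ x, x = 0 ∨ 7 ≤ x → σ'.reg x = σ.reg x) :
    Simulates W W' R up low σ₀ (s.setMem a v) σ' where
  reg x hx := by rw [setMem_reg, hreg _ (by omega), h.reg x hx]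
  reg_lt x := h.reg_lt x
  control x hx hx' := by rw [hreg x hx', h.control x hx hx']
  mem x := by
    rw [setMem_mem, h.mem, hmem]
    unfold layer
    by_cases hxa : x = a
    · subst hxa
      simp
    · rw [if_neg hxa]
      simp only [show 6 * x + up ≠ 6 * a + up + 1 by omega, show 6 * x + up ≠ 6 * a + up by omega,
        show 6 * x + up + 1 ≠ 6 * a + up + 1 by omega,
        show 6 * x + up + 1 ≠ 6 * a + up by omega, if_false]
  frame y hy hy' := by
    rw [hmem]
    simp only [show y ≠ 6 * a + up + 1 by omega, show y ≠ 6 * a + up by omega, if_false]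
    exact h.frame y hy hy'
  mem_lt y := by
    rw [hmem]
    dsimp only
    split_ifs
    exacts [lt_of_lt_of_le hv hW, h13, h.mem_lt y]
  stamp x := by
    rw [hmem]
    simp only [show 6 * x + up ≠ 6 * a + up + 1 by omega, if_false]
    split_ifs
    exacts [Or.inr rfl, h.stamp x]

theorem Simulates.virtualLoad (h : Simulates W W' R up low σ₀ s σ) (hW : 6 * W + 6 < W')
    (hup : up ≤ 4) (hlow : low ≤ 4) (h1 : low ≠ up) (h2 : low ≠ up + 1) (h3 : up ≠ low + 1)
    {r a : ℕ} (ha : a < R) (hv : s.mem (s.reg a) < W) :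
    Runs W' inp (virtualLoad up low (r + 20) (a + 20)) σ fun t σ' => t ≤ 30 ∧
      Simulates W W' R up low σ₀ (s.setReg r (s.mem (s.reg a))) σ' := by
  have haW := h.reg_lt a
  have key : ∀ σ' : State, σ'.mem = σ.mem →
      (∀ x, x = 0 ∨ 7 ≤ x → x ≠ r + 20 → σ'.reg x = σ.reg x) →
      σ'.reg (r + 20) = s.mem (s.reg a) →
      Simulates W W' R up low σ₀ (s.setReg r (s.mem (s.reg a))) σ' :=
    fun σ' h h' h'' => Simulates.setReg ‹_› hv h h'' h'
  have hm := h.mem (s.reg a)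
  unfold layer at hm
  simp only [FrechetANN.virtualLoad, runs_block_cons, runs_block_nil, runs_const, runs_load,
    runs_op, runs_cond, setReg_reg, setReg_mem, BinOp.eval, Nat.reduceEqDiff, if_true, if_false,
    h.reg a ha, h.control 13 (by omega) (by omega), h.control 14 (by omega) (by omega)]
  have hlow0 := h.frame (6 * s.reg a + low) (by omega) (by omega)
  have hlow1 := h.frame (6 * s.reg a + low + 1) (by omega) (by omega)
  rw [mul_comm (s.reg a) 6, hlow0, hlow1]
  have hl := h.mem_lt
  refine ⟨by omega, by omega, by omega, by omega, hl _, by split_ifs <;> omega, by omega, ?_⟩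
  by_cases c1 : σ.mem (6 * s.reg a + up) = σ₀.reg 13
  · simp only [c1, if_true, one_ne_zero, if_false] at hm ⊢
    refine ⟨by omega, hl _, by omega, ?_⟩
    refine key _ rfl (fun x hx hx' => ?_) ?_
    · simp only [setReg_reg]
      simp only [hx', if_false, show x ≠ 2 by omega, show x ≠ 3 by omega, show x ≠ 4 by omega,
        show x ≠ 1 by omega]
    · simp [setReg_reg, hm]
  · simp only [c1, if_true, if_false] at hm ⊢
    refine ⟨by omega, by omega, hlow0 ▸ hl _, by split_ifs <;> omega, ?_⟩
    by_cases c2 : σ₀.mem (6 * s.reg a + low) = σ₀.reg 14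
    · simp only [c2, if_true, one_ne_zero, if_false] at hm ⊢
      refine ⟨by omega, hlow1 ▸ hl _, by omega, ?_⟩
      refine key _ rfl (fun x hx hx' => ?_) ?_
      · simp only [setReg_reg]
        simp only [hx', if_false, show x ≠ 2 by omega, show x ≠ 3 by omega,
          show x ≠ 4 by omega, show x ≠ 1 by omega]
      · simp [setReg_reg, hm]
    · simp only [c2, if_true, if_false] at hm ⊢
      refine ⟨by omega, by omega, ?_⟩
      refine key _ rfl (fun x hx hx' => ?_) ?_
      · simp only [setReg_reg]
        simp only [hx', if_false, show x ≠ 2 by omega, show x ≠ 3 by omega,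
          show x ≠ 4 by omega, show x ≠ 1 by omega]
      · simp [setReg_reg, hm]

theorem Simulates.virtualStore (h : Simulates W W' R up low σ₀ s σ) (hW : 6 * W + 6 < W')
    (hup : up ≤ 4) (h13 : σ₀.reg 13 < W') {r a : ℕ} (ha : a < R) (hr : r < R) :
    Runs W' inp (virtualStore up (a + 20) (r + 20)) σ fun t σ' => t ≤ 30 ∧
      Simulates W W' R up low σ₀ (s.setMem (s.reg a) (s.reg r)) σ' := by
  have haW := h.reg_lt a
  simp only [FrechetANN.virtualStore, runs_block_cons, runs_block_nil, runs_const, runs_store,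
    runs_op, setReg_reg, setMem_reg, BinOp.eval, Nat.reduceEqDiff, if_true, if_false,
    h.reg a ha, h.reg r hr, h.control 13 (by omega) (by omega)]
  refine ⟨by omega, by omega, by omega, by omega, by omega, by omega, by omega, ?_⟩
  refine h.setMem (by omega) hup h13 (h.reg_lt r) ?_ (fun x hx => ?_)
  · funext y
    simp only [setMem_mem, setReg_mem]
    rw [mul_comm (s.reg a) 6]
  · simp only [setMem_reg, setReg_reg, show x ≠ 2 by omega, show x ≠ 3 by omega,
      show x ≠ 4 by omega, show x ≠ 1 by omega, if_false]

/-- A simulated run takes only a constant factor longer than the original one. -/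
theorem exec_simulate {κ : ℕ} (hW : 6 * W + 6 < W')
    (hup : up ≤ 4) (hlow : low ≤ 4) (h1 : low ≠ up) (h2 : low ≠ up + 1) (h3 : up ≠ low + 1)
    (h13 : σ₀.reg 13 < W') (hrd : ReadsInput W W' inp vinp κ rd σ₀)
    {p : Prog} {t : ℕ} {s' : State} (he : Exec W vinp p s t s') (hp : RegsLt R p)
    (h : Simulates W W' R up low σ₀ s σ) :
    Runs W' inp (simulate rd up low p) σ fun t' σ' =>
      t' ≤ (κ + 30) * t ∧ Simulates W W' R up low σ₀ s' σ' := by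
  induction he generalizing σ with
  | skip s => exact runs_skip.2 ⟨by omega, h⟩
  | const s r v hv =>
    refine runs_const.2 ⟨by omega, by omega, h.setReg hv rfl (by simp [setReg_reg]) ?_⟩
    exact fun x _ hx => by simp [setReg_reg, hx]
  | op s o r a b hv =>
    obtain ⟨hr, ha, hb⟩ := hp
    simp only [simulate, runs_op, h.reg a ha, h.reg b hb]
    refine ⟨by omega, by omega, h.setReg hv rfl (by simp [setReg_reg]) ?_⟩
    exact fun x _ hx => by simp [setReg_reg, hx]
  | load s r a hv =>
    refine (h.virtualLoad hW hup hlow h1 h2 h3 hp.2 hv).mono fun t' σ' ⟨ht, hs⟩ => ⟨?_, hs⟩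
    omega
  | store s a r =>
    refine (h.virtualStore hW hup h13 hp.1 hp.2).mono fun t' σ' ⟨ht, hs⟩ => ⟨?_, hs⟩
    omega
  | read s r a hv =>
    have haW := h.reg_lt a
    simp only [simulate, runs_block_cons, runs_block_nil, runs_const,
      runs_op, setReg_reg, BinOp.eval, Nat.reduceEqDiff, if_true, if_false, h.reg a hp.2,
      zero_add, add_zero, OfNat.one_ne_ofNat]
    refine ⟨by omega, by omega, ?_⟩
    refine (hrd _ (fun x hx hx' => ?_) ?_).mono ?_
    · simp only [setReg_reg, show x ≠ 1 by omega, if_false]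
      exact h.control x hx hx'
    · simpa [setReg_reg] using haW
    · rintro t' σ' ⟨ht', hσ1, hmem, hreg⟩
      simp only [setReg_reg, if_true] at hσ1
      rw [hσ1]
      refine ⟨by omega, by omega, by omega, h.setReg hv ?_ (by simp [setReg_reg]) ?_⟩
      · rw [setReg_mem, setReg_mem, hmem, setReg_mem, setReg_mem]
      · intro x hx hx'
        simp only [setReg_reg, hx', show x ≠ 2 by omega, if_false, hreg x hx,
          show x ≠ 1 by omega]
  | seq _ _ ihp ihq =>
    refine runs_seq.2 ((ihp hp.1 h).mono fun t' σ' ⟨ht, hs⟩ =>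
      (ihq hp.2 hs).mono fun t'' σ'' ⟨ht', hs'⟩ => ⟨?_, hs'⟩)
    rw [mul_add]
    omega
  | cond_true h0 _ ih =>
    refine runs_cond.2 ?_
    rw [h.reg _ hp.1, if_neg h0]
    refine (ih hp.2.1 h).mono fun t' σ' ⟨ht, hs⟩ => ⟨?_, hs⟩
    rw [mul_add]
    omega
  | cond_false h0 _ ih =>
    refine runs_cond.2 ?_
    rw [h.reg _ hp.1, if_pos h0]
    refine (ih hp.2.2 h).mono fun t' σ' ⟨ht, hs⟩ => ⟨?_, hs⟩
    rw [mul_add]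
    omega
  | loop_true h0 _ _ ihp ihl =>
    obtain ⟨t₁, σ₁, he₁, ht₁, hs₁⟩ := ihp hp.2 h
    obtain ⟨t₂, σ₂, he₂, ht₂, hs₂⟩ := ihl hp hs₁
    refine ⟨_, _, .loop_true (by rwa [h.reg _ hp.1]) he₁ he₂, ?_, hs₂⟩
    rw [mul_add, mul_add]
    omega
  | loop_false h0 =>
    exact ⟨_, _, .loop_false (by rwa [h.reg _ hp.1]), by omega, h⟩

end

/-- Set the simulated registers below `R` to `0`. -/
def clearRegs : ℕ → Prog
  | 0 => .skip
  | R + 1 => .seq (clearRegs R) (.const (R + 20) 0)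

theorem runs_clearRegs {W : ℕ} (hW : 0 < W) (inp : List ℕ) (R : ℕ) (s : State) :
    Runs W inp (clearRegs R) s fun t s' => t = R + 1 ∧ s'.mem = s.mem ∧
      (∀ r < 20, s'.reg r = s.reg r) ∧ ∀ r < R, s'.reg (r + 20) = 0 := by
  induction R with
  | zero => exact runs_skip.2 ⟨rfl, rfl, fun _ _ => rfl, fun r hr => by omega⟩
  | succ R ih =>
    refine runs_seq.2 (ih.mono fun t s' ⟨ht, hm, hc, hr⟩ => runs_const.2 ⟨hW, by omega, hm, ?_, ?_⟩)
    · intro r hr'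
      rw [setReg_reg, if_neg (by omega), hc r hr']
    · intro r hr'
      rw [setReg_reg]
      split_ifs with h
      exacts [rfl, hr r (by omega)]

/-! ### The Fréchet distance of the gadget curves -/

/-- Vertex number `j` of the curve of a 0-1-vector with the coordinates `a 0, a 1, …`. Coordinate
`i` contributes the two vertices `2 * i + 3 + e` and `2 * i + 3 - e`, where `e` is `u` if the
coordinate is nonzero, and `v` otherwise. -/
def gadgetVertex (u v : ℕ) (a : ℕ → ℕ) (j : ℕ) : ℕ :=
  if j % 2 = 0 then 2 * (j / 2) + 3 + if a (j / 2) = 0 then v else u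
  else 2 * (j / 2) + 3 - if a (j / 2) = 0 then v else u

/-- The polygonal curve with the first `m` vertices of `gadgetVertex`. -/
def gadgetCurve (u v m : ℕ) (a : ℕ → ℕ) : Fin m → ℚ := fun j => gadgetVertex u v a j

theorem gadgetVertex_le {u v : ℕ} (hu : u ≤ 3) (hv : v ≤ 3) (a : ℕ → ℕ) (j : ℕ) :
    gadgetVertex u v a j ≤ j + 6 := by
  unfold gadgetVertex
  split_ifs <;> omega

theorem gadgetCurve_ratBounded {u v m B : ℕ} (hu : u ≤ 3) (hv : v ≤ 3) (hB : m + 6 ≤ B)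
    (a : ℕ → ℕ) (j : Fin m) : RatBounded B (gadgetCurve u v m a j) := by
  have := gadgetVertex_le hu hv a j
  have := j.2
  refine ⟨?_, ?_⟩
  · simp only [gadgetCurve, Rat.num_natCast, Int.natAbs_natCast]
    omega
  · simp only [gadgetCurve, Rat.den_natCast]
    omega

/-- The vertex of a polygonal curve, continued by `0` after the last vertex. -/
noncomputable def vertexOrZero {m : ℕ} (p : Fin m → ℚ) (i : ℕ) : ℝ :=
  if h : i < m then (p ⟨i, h⟩ : ℝ) else 0

theorem polyCurve_eq {m : ℕ} (p : Fin m → ℚ) (t : unitInterval) :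
    polyCurve p t = (1 - ((t : ℝ) * (m - 1) - ⌊(t : ℝ) * (m - 1)⌋₊)) *
      vertexOrZero p ⌊(t : ℝ) * (m - 1)⌋₊ +
      ((t : ℝ) * (m - 1) - ⌊(t : ℝ) * (m - 1)⌋₊) * vertexOrZero p (⌊(t : ℝ) * (m - 1)⌋₊ + 1) :=
  rfl

/-- The point of a polygonal curve at a given time is its `k`-th vertex or lies on the edge from
this vertex to the next one, for a suitable `k`. -/
theorem polyCurve_cases {m : ℕ} (hm : 1 ≤ m) (p : Fin m → ℚ) (t : unitInterval) :
    ∃ k : ℕ, (k : ℝ) ≤ (t : ℝ) * (m - 1) ∧ k < m ∧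
      (((t : ℝ) * (m - 1) = k ∧ polyCurve p t = vertexOrZero p k) ∨
      (k + 1 < m ∧ ∃ x : ℝ, 0 < x ∧ x < 1 ∧ (t : ℝ) * (m - 1) = k + x ∧
        polyCurve p t = (1 - x) * vertexOrZero p k + x * vertexOrZero p (k + 1))) := by
  have hm' : (1 : ℝ) ≤ m := by exact_mod_cast hm
  set y : ℝ := (t : ℝ) * (m - 1) with hy
  have hy0 : 0 ≤ y := mul_nonneg t.2.1 (by linarith)
  have hy1 : y ≤ m - 1 := mul_le_of_le_one_left (by linarith) t.2.2
  have hf := Nat.floor_le hy0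
  have hf' := Nat.lt_floor_add_one y
  have hp := polyCurve_eq p t
  rw [← hy] at hp
  have hlt : ⌊y⌋₊ < m := by
    have : (⌊y⌋₊ : ℝ) < m := by linarith
    exact_mod_cast this
  refine ⟨⌊y⌋₊, hf, hlt, ?_⟩
  rcases hf.eq_or_lt with he | hl
  · left
    refine ⟨he.symm, ?_⟩
    rw [hp, ← he]
    simp
  · right
    refine ⟨?_, y - ⌊y⌋₊, by linarith, by linarith, by ring, hp⟩
    have : (⌊y⌋₊ : ℝ) + 1 < m + 1 - 1 + 0 ∨ (m : ℝ) ≤ ⌊y⌋₊ + 1 := by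
      rcases lt_or_ge ((⌊y⌋₊ : ℝ) + 1) m with h | h
      · left; linarith
      · right; exact h
    rcases this with h | h
    · have : (⌊y⌋₊ : ℝ) + 1 < m := by linarith
      exact_mod_cast this
    · linarith

theorem polyCurve_vertex {m : ℕ} (p : Fin m → ℚ) (t : unitInterval) {k : ℕ} (hk : k < m)
    (ht : (t : ℝ) * (m - 1) = k) : polyCurve p t = p ⟨k, hk⟩ := by
  rw [polyCurve_eq, ht]
  simp [vertexOrZero, hk]

theorem exists_vertex_time {m k : ℕ} (hm : 2 ≤ m) (hk : k < m) :
    ∃ t : unitInterval, (t : ℝ) * (m - 1) = k := by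
  have hm' : (2 : ℝ) ≤ m := by exact_mod_cast hm
  have hk' : (k : ℝ) + 1 ≤ m := by exact_mod_cast hk
  refine ⟨⟨k / (m - 1), div_nonneg (Nat.cast_nonneg k) (by linarith), ?_⟩, ?_⟩
  · rw [div_le_one (by linarith)]
    linarith
  · exact div_mul_cancel₀ _ (by linarith)

/-- A lower bound for the vertices from number `k₀` on is one for the rest of the curve from this
vertex on. -/
theorem le_polyCurve {m k₀ : ℕ} (hm : 1 ≤ m) (p : Fin m → ℚ) {b : ℝ}
    (h : ∀ k : Fin m, k₀ ≤ k → b ≤ p k) (t : unitInterval) (ht : (k₀ : ℝ) ≤ (t : ℝ) * (m - 1)) :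
    b ≤ polyCurve p t := by
  obtain ⟨k, -, hkm, ⟨he, hp⟩ | ⟨hk1, x, hx0, hx1, he, hp⟩⟩ := polyCurve_cases hm p t
  · have hk : k₀ ≤ k := by
      rw [he] at ht
      exact_mod_cast ht
    rw [hp, vertexOrZero, dif_pos hkm]
    exact h ⟨k, hkm⟩ hk
  · have hk : k₀ < k + 1 := by
      have : (k₀ : ℝ) < k + 1 := by linarith
      exact_mod_cast this
    rw [hp, vertexOrZero, vertexOrZero, dif_pos hkm, dif_pos hk1]
    have h1 := h ⟨k, hkm⟩ (by simpa using Nat.le_of_lt_succ hk)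
    have h2 := h ⟨k + 1, hk1⟩ hk.le
    nlinarith

theorem polyCurve_le {m k₀ : ℕ} (hm : 1 ≤ m) (p : Fin m → ℚ) {b : ℝ}
    (h : ∀ k : Fin m, k ≤ k₀ → (p k : ℝ) ≤ b) (t : unitInterval)
    (ht : (t : ℝ) * (m - 1) ≤ k₀) : polyCurve p t ≤ b := by
  obtain ⟨k, hk0, hkm, ⟨he, hp⟩ | ⟨hk1, x, hx0, hx1, he, hp⟩⟩ := polyCurve_cases hm p t
  · have hk : k ≤ k₀ := by
      have := hk0.trans ht
      exact_mod_cast this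
    rw [hp, vertexOrZero, dif_pos hkm]
    exact h ⟨k, hkm⟩ hk
  · have hk : k < k₀ := by
      have : (k : ℝ) < k₀ := by linarith
      exact_mod_cast this
    rw [hp, vertexOrZero, vertexOrZero, dif_pos hkm, dif_pos hk1]
    have h1 := h ⟨k, hkm⟩ hk.le
    have h2 := h ⟨k + 1, hk1⟩ hk
    nlinarith

theorem exists_abs_polyCurve_le {m : ℕ} (hm : 1 ≤ m) (p : Fin m → ℚ) :
    ∃ B : ℝ, ∀ t, |polyCurve p t| ≤ B := by
  refine ⟨∑ j, |(p j : ℝ)|, fun t => abs_le.2 ⟨?_, ?_⟩⟩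
  · refine le_polyCurve (k₀ := 0) hm p (fun k _ => ?_) t
      (Nat.cast_zero.trans_le (mul_nonneg t.2.1 ?_))
    · have := Finset.single_le_sum (f := fun j => |(p j : ℝ)|) (fun j _ => abs_nonneg _)
        (Finset.mem_univ k)
      have h' := neg_abs_le (p k : ℝ)
      linarith
    · have : (1 : ℝ) ≤ m := by exact_mod_cast hm
      linarith
  · refine polyCurve_le (k₀ := m) hm p (fun k _ => ?_) t ?_
    · have := Finset.single_le_sum (f := fun j => |(p j : ℝ)|) (fun j _ => abs_nonneg _)
        (Finset.mem_univ k)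
      exact (le_abs_self _).trans this
    · have : (1 : ℝ) ≤ m := by exact_mod_cast hm
      exact (mul_le_of_le_one_left (by linarith) t.2.2).trans (by linarith)

/-- The identity as a reparametrization. -/
def Reparam.refl : Reparam := ⟨id, monotone_id, Function.surjective_id⟩

/-- Traversing two curves with the same number of vertices at the same speed bounds their Fréchet
distance by the largest distance of corresponding vertices. -/
theorem frechetDist_le {m : ℕ} (hm : 1 ≤ m) (p q : Fin m → ℚ) {b : ℝ}
    (h : ∀ k, |(p k : ℝ) - q k| ≤ b) : frechetDist (polyCurve p) (polyCurve q) ≤ b := by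
  refine (ciInf_le ⟨0, ?_⟩ (Reparam.refl, Reparam.refl)).trans (ciSup_le fun t => ?_)
  · rintro _ ⟨fg, rfl⟩
    exact Real.iSup_nonneg fun t => abs_nonneg _
  · simp only [Reparam.refl, id]
    obtain ⟨k, -, hkm, ⟨he, hp⟩ | ⟨hk1, x, hx0, hx1, he, hp⟩⟩ := polyCurve_cases hm p t
    · rw [polyCurve_vertex p t hkm he, polyCurve_vertex q t hkm he]
      exact h _
    · have hf : ⌊(t : ℝ) * (m - 1)⌋₊ = k := by
        rw [he]
        exact (Nat.floor_eq_iff (by positivity)).2 ⟨by linarith, by linarith⟩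
      rw [polyCurve_eq q t, hp, hf, he]
      simp only [vertexOrZero, dif_pos hkm, dif_pos hk1, add_sub_cancel_left]
      have h1 := abs_le.1 (h ⟨k, hkm⟩)
      have h2 := abs_le.1 (h ⟨k + 1, hk1⟩)
      refine abs_le.2 ⟨?_, ?_⟩ <;> nlinarith

/-- If `P` visits points far above and then far below the level `c`, while `Q` stays below `c`
before some time and above `c` after it, then the curves are far from each other. -/
theorem le_frechetDist {P Q : unitInterval → ℝ} {b c : ℝ} (hP : ∃ B, ∀ t, |P t| ≤ B)
    (hQ : ∃ B, ∀ t, |Q t| ≤ B) {t₁ t₂ τ : unitInterval} (ht : t₁ ≤ t₂)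
    (h1 : c + b ≤ P t₁) (h2 : P t₂ ≤ c - b) (hl : ∀ t ≤ τ, Q t ≤ c) (hr : ∀ t, τ ≤ t → c ≤ Q t) :
    b ≤ frechetDist P Q := by
  have : Nonempty (Reparam × Reparam) := ⟨(Reparam.refl, Reparam.refl)⟩
  refine le_ciInf fun ⟨⟨f, hf, hfs⟩, ⟨g, hg, hgs⟩⟩ => ?_
  dsimp only
  have hbdd : BddAbove (Set.range fun t => |P (f t) - Q (g t)|) := by
    obtain ⟨B, hB⟩ := hP
    obtain ⟨B', hB'⟩ := hQ
    refine ⟨B + B', ?_⟩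
    rintro _ ⟨t, rfl⟩
    exact (abs_sub _ _).trans (add_le_add (hB _) (hB' _))
  by_contra hlt
  push Not at hlt
  have hall : ∀ t, |P (f t) - Q (g t)| < b := fun t => (le_ciSup hbdd t).trans_lt hlt
  obtain ⟨s₁, rfl⟩ := hfs t₁
  obtain ⟨s₂, rfl⟩ := hfs t₂
  have k1 := abs_lt.1 (hall s₁)
  have k2 := abs_lt.1 (hall s₂)
  -- at the time `s₁`, the curve `Q` is above the level `c`, and at `s₂`, it is below
  have hs1 : τ < g s₁ := by
    by_contra hcon
    have := hl _ (not_lt.1 hcon)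
    linarith [k1.2]
  have hs2 : g s₂ < τ := by
    by_contra hcon
    have := hr _ (not_lt.1 hcon)
    linarith [k2.1]
  have hs : s₂ ≤ s₁ := by
    by_contra hcon
    exact absurd (hg (not_le.1 hcon).le) (not_le.2 (hs2.trans hs1))
  have heq : f s₁ = f s₂ := le_antisymm ht (hf hs)
  rw [heq] at h1
  have hb : 0 < b := (abs_nonneg _).trans_lt (hall s₁)
  linarith

theorem frechetDist_gadgetCurve_le {m : ℕ} (hm : 1 ≤ m) {a b : ℕ → ℕ}
    (h : ∀ i, a i = 0 ∨ b i = 0) :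
    frechetDist (polyCurve (gadgetCurve 3 1 m a)) (polyCurve (gadgetCurve 0 2 m b)) ≤ 1 := by
  refine frechetDist_le hm _ _ fun k => ?_
  have : gadgetVertex 3 1 a k ≤ gadgetVertex 0 2 b k + 1 ∧
      gadgetVertex 0 2 b k ≤ gadgetVertex 3 1 a k + 1 := by
    unfold gadgetVertex
    rcases h (k / 2) with h | h <;> simp only [h, if_true] <;> split_ifs <;> omega
  have h1 : (gadgetVertex 3 1 a k : ℝ) ≤ gadgetVertex 0 2 b k + 1 := by exact_mod_cast this.1
  have h2 : (gadgetVertex 0 2 b k : ℝ) ≤ gadgetVertex 3 1 a k + 1 := by exact_mod_cast this.2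
  simp only [gadgetCurve, Rat.cast_natCast]
  exact abs_le.2 ⟨by linarith, by linarith⟩

theorem le_frechetDist_gadgetCurve {m i : ℕ} (hi : 2 * i + 1 < m) {a b : ℕ → ℕ}
    (ha : a i ≠ 0) (hb : b i ≠ 0) :
    3 ≤ frechetDist (polyCurve (gadgetCurve 3 1 m a)) (polyCurve (gadgetCurve 0 2 m b)) := by
  obtain ⟨t₁, ht₁⟩ := exists_vertex_time (m := m) (k := 2 * i) (by omega) (by omega)
  obtain ⟨t₂, ht₂⟩ := exists_vertex_time (m := m) (k := 2 * i + 1) (by omega) hi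
  have hm : (0 : ℝ) < m - 1 := by
    have : (1 : ℝ) < m := by exact_mod_cast (by omega : 1 < m)
    linarith
  refine le_frechetDist (c := 2 * i + 3) (t₁ := t₁) (t₂ := t₂) (τ := t₁)
    (exists_abs_polyCurve_le (by omega) _) (exists_abs_polyCurve_le (by omega) _) ?_ ?_ ?_ ?_ ?_
  · rw [← Subtype.coe_le_coe]
    refine le_of_mul_le_mul_right ?_ hm
    rw [ht₁, ht₂]
    push_cast
    linarith
  · rw [polyCurve_vertex _ t₁ (by omega) ht₁]
    have : gadgetVertex 3 1 a (2 * i) = 2 * i + 6 := by simp [gadgetVertex, ha]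
    simp only [gadgetCurve, this]
    push_cast
    linarith
  · rw [polyCurve_vertex _ t₂ hi ht₂]
    have : gadgetVertex 3 1 a (2 * i + 1) = 2 * i := by
      simp [gadgetVertex, show (2 * i + 1) / 2 = i by omega, show (2 * i + 1) % 2 = 1 by omega, ha]
    simp only [gadgetCurve, this]
    push_cast
    linarith
  · refine fun t ht => polyCurve_le (k₀ := 2 * i) (by omega) _ (fun k hk => ?_) t ?_
    · have : gadgetVertex 0 2 b k ≤ 2 * i + 3 := by
        unfold gadgetVertex
        rcases Nat.lt_or_ge (k / 2) i with h | h
        · split_ifs <;> omega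
        · rw [show (k : ℕ) / 2 = i by omega, if_neg hb]
          split_ifs <;> omega
      simp only [gadgetCurve, Rat.cast_natCast]
      exact_mod_cast this
    · rw [← ht₁]
      exact mul_le_mul_of_nonneg_right ht hm.le
  · refine fun t ht => le_polyCurve (k₀ := 2 * i) (by omega) _ (fun k hk => ?_) t ?_
    · have : 2 * i + 3 ≤ gadgetVertex 0 2 b k := by
        unfold gadgetVertex
        rcases Nat.lt_or_ge i (k / 2) with h | h
        · split_ifs <;> omega
        · rw [show (k : ℕ) / 2 = i by omega, if_neg hb]
          split_ifs <;> omega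
      simp only [gadgetCurve, Rat.cast_natCast]
      exact_mod_cast this
    · rw [← ht₁]
      exact mul_le_mul_of_nonneg_right ht hm.le

/-- The coordinates of a 0-1-vector, continued by zeros. -/
def bits {d : ℕ} (a : Fin d → Bool) (i : ℕ) : ℕ := if h : i < d then (a ⟨i, h⟩).toNat else 0

theorem orthogonal_iff {d : ℕ} (a b : Fin d → Bool) :
    Orthogonal a b ↔ ∀ i, bits a i = 0 ∨ bits b i = 0 := by
  unfold Orthogonal bits
  rw [Finset.sum_eq_zero_iff]
  constructor
  · intro h i
    by_cases hi : i < d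
    · simpa [hi] using h ⟨i, hi⟩ (Finset.mem_univ _)
    · simp [hi]
  · intro h i _
    simpa using h i

theorem gadgetCurve_bits_injective {d m : ℕ} (hm : 2 * d ≤ m) :
    Function.Injective fun a : Fin d → Bool => gadgetCurve 3 1 m (bits a) := by
  intro a b hab
  funext i
  have h := congrFun hab ⟨2 * i, by have := i.2; omega⟩
  have h' : gadgetVertex 3 1 (bits a) (2 * i) = gadgetVertex 3 1 (bits b) (2 * i) := by
    simpa [gadgetCurve] using h
  simp only [gadgetVertex, bits, Nat.mul_mod_right, if_true,
    Nat.mul_div_cancel_left (i : ℕ) two_pos, i.2, dif_pos, Fin.eta] at h'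
  cases ha : a i <;> cases hb : b i <;> simp [ha, hb] at h' ⊢

/-- A near neighbor data structure with approximation factor below `3` tells whether some stored
vector is orthogonal to the query vector. -/
theorem CorrectAnswer.ne_none_iff {n d m : ℕ} {γ : ℝ} (hγ : γ < 3) (hd : 1 ≤ m) (hm : 2 * d ≤ m)
    {A : Fin n → Fin d → Bool} {b : Fin d → Bool} {ans : Option (Fin n)}
    (h : CorrectAnswer γ 1 (fun i => gadgetCurve 3 1 m (bits (A i))) (gadgetCurve 0 2 m (bits b))
      ans) :
    ans ≠ none ↔ ∃ i, Orthogonal (A i) b := by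
  constructor
  · intro hne
    by_contra hcon
    push Not at hcon
    refine hne (h.2.1 fun i => ?_)
    have hi := hcon i
    rw [orthogonal_iff] at hi
    push Not at hi
    obtain ⟨k, hk, hk'⟩ := hi
    have hkd : k < d := by
      by_contra hkd
      simp [bits, hkd] at hk
    have := le_frechetDist_gadgetCurve (m := m) (i := k) (by omega) hk hk'
    linarith
  · rintro ⟨i, hi⟩
    obtain ⟨j, rfl, -⟩ :=
      h.1 ⟨i, frechetDist_gadgetCurve_le hd ((orthogonal_iff _ _).1 hi)⟩
    simp

/-! ### The words of the instances -/

theorem getD_flatten_ofFn {L n : ℕ} (hL : 0 < L) (f : Fin n → List ℕ)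
    (hf : ∀ i, (f i).length = L) (x : ℕ) :
    (List.ofFn f).flatten.getD x 0 =
      if h : x / L < n then (f ⟨x / L, h⟩).getD (x % L) 0 else 0 := by
  induction n generalizing x with
  | zero => simp
  | succ n ih =>
    rw [List.ofFn_succ, List.flatten_cons]
    rcases Nat.lt_or_ge x L with hx | hx
    · rw [List.getD_append _ _ _ _ (by rw [hf]; exact hx)]
      simp [Nat.div_eq_of_lt hx, Nat.mod_eq_of_lt hx]
    · rw [List.getD_append_right _ _ _ _ (by rw [hf]; exact hx), hf, ih _ fun i => hf i.succ]
      have hdiv : x / L = (x - L) / L + 1 := Nat.div_eq_sub_div hL hx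
      rw [← Nat.mod_eq_sub_mod hx]
      by_cases h : (x - L) / L < n
      · rw [dif_pos h, dif_pos (by omega)]
        congr 2
        exact Fin.ext hdiv.symm
      · rw [dif_neg h, dif_neg (by omega)]

/-- The input word number `y` of `n` gadget curves with `m` vertices each, one after the other;
`row i` is the vector of the `i`-th curve. -/
def curveWord (u v m n : ℕ) (row : ℕ → ℕ → ℕ) (y : ℕ) : ℕ :=
  if y < m * n * 3 then
    if y % 3 = 1 then gadgetVertex u v (row (y / 3 / m)) (y / 3 % m) else y % 3 / 2
  else 0

theorem length_encodeCurve {m : ℕ} (p : Fin m → ℚ) : (encodeCurve p).length = 3 * m := by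
  simp [encodeCurve, encodeRat, List.length_flatten, List.map_ofFn, Function.comp_def, mul_comm]

theorem getD_encodeCurve (u v m : ℕ) (a : ℕ → ℕ) (y : ℕ) :
    (encodeCurve (gadgetCurve u v m a)).getD y 0 = curveWord u v m 1 (fun _ => a) y := by
  unfold encodeCurve curveWord
  rw [getD_flatten_ofFn (L := 3) (by omega) _ (fun i => by simp [encodeRat])]
  by_cases h : y / 3 < m
  · rw [dif_pos h, if_pos (by omega), Nat.mod_eq_of_lt h]
    have h3 : y % 3 < 3 := Nat.mod_lt _ (by omega)
    have hneg : ¬ (gadgetVertex u v a (y / 3) : ℚ) < 0 := not_lt.2 (Nat.cast_nonneg _)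
    simp only [encodeRat, gadgetCurve, hneg, if_false, Rat.num_natCast, Int.natAbs_natCast,
      Rat.den_natCast]
    interval_cases y % 3 <;> rfl
  · rw [dif_neg h, if_neg (by omega)]

theorem getD_flatten_encodeCurve {u v m n : ℕ} (hm : 0 < m) (row : ℕ → ℕ → ℕ) (y : ℕ) :
    (List.ofFn fun i : Fin n => encodeCurve (gadgetCurve u v m (row i))).flatten.getD y 0 =
      curveWord u v m n row y := by
  rw [getD_flatten_ofFn (L := 3 * m) (by omega) _ (fun i => length_encodeCurve _)]
  have hdiv : y / (3 * m) = y / 3 / m := (Nat.div_div_eq_div_mul _ _ _).symm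
  have hiff : y / (3 * m) < n ↔ y < m * n * 3 := by
    rw [Nat.div_lt_iff_lt_mul (by omega)]
    have : n * (3 * m) = m * n * 3 := by ring
    rw [this]
  by_cases h : y / (3 * m) < n
  · rw [dif_pos h, getD_encodeCurve]
    unfold curveWord
    have hlt : y % (3 * m) < 3 * m := Nat.mod_lt _ (by omega)
    have hmod : y % (3 * m) % 3 = y % 3 := Nat.mod_mul_right_mod _ _ _
    have hdm : y % (3 * m) / 3 = y / 3 % m := Nat.mod_mul_right_div_self _ _ _
    rw [if_pos (hiff.1 h), if_pos (by omega), hmod, hdm, Nat.mod_mod]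
    simp only [hdiv]
  · rw [dif_neg h]
    unfold curveWord
    rw [if_neg (mt hiff.2 h)]

theorem getD_annInput {n m : ℕ} (hm : 0 < m) (row : ℕ → ℕ → ℕ) (x : ℕ) :
    (annInput m 1 fun i : Fin n => gadgetCurve 3 1 m (row i)).getD x 0 =
      if x < 6 then if x = 0 then n else if x < 3 then m else if x = 3 then 0 else 1
      else curveWord 3 1 m n row (x - 6) := by
  have h0 : encodeRat 1 = [0, 1, 1] := by simp [encodeRat]
  unfold annInput
  rw [h0]
  split_ifs with h6 hx0 hx3 hx3'
  · subst hx0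
    simp
  · obtain rfl | rfl : x = 1 ∨ x = 2 := by omega
    all_goals simp
  · subst hx3'
    simp
  · obtain rfl | rfl : x = 4 ∨ x = 5 := by omega
    all_goals simp
  · rw [← getD_flatten_encodeCurve hm, List.getD_append_right _ _ _ _ (by simpa using h6)]
    rfl

theorem length_encodeVectors {N d : ℕ} (A : Fin N → Fin d → Bool) :
    (encodeVectors A).length = N * d := by
  simp [encodeVectors, List.length_flatten, List.map_ofFn, Function.comp_def]

theorem getD_encodeVectors {N d : ℕ} (A : Fin N → Fin d → Bool) (i : Fin N) {k : ℕ} (hk : k < d) :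
    (encodeVectors A).getD (i * d + k) 0 = bits (A i) k := by
  unfold encodeVectors
  have hdiv : (i * d + k) / d = i := by
    rw [mul_comm, Nat.mul_add_div (by omega), Nat.div_eq_of_lt hk, add_zero]
  have hmod : (i * d + k) % d = k := by
    rw [mul_comm, Nat.mul_add_mod, Nat.mod_eq_of_lt hk]
  rw [getD_flatten_ofFn (L := d) (by omega) _ (fun i => by simp), dif_pos (by rw [hdiv]; exact i.2),
    hmod]
  simp only [hdiv, Fin.eta, bits, dif_pos hk]
  rw [List.getD_eq_getElem _ _ (by simpa using hk)]
  simp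

section

variable {N d : ℕ} (A B : Fin N → Fin d → Bool)

theorem getD_ovInput_zero : (ovInput A B).getD 0 0 = N := by simp [ovInput]

theorem getD_ovInput_one : (ovInput A B).getD 1 0 = d := by simp [ovInput]

theorem getD_ovInput_left (i : Fin N) {k : ℕ} (hk : k < d) :
    (ovInput A B).getD (i * d + k + 2) 0 = bits (A i) k := by
  have hlt : i * d + k < N * d := by
    have := Nat.mul_le_mul_right d (Nat.succ_le_of_lt i.2)
    rw [Nat.succ_mul] at this
    omega
  unfold ovInput
  rw [List.append_assoc, List.getD_append_right _ _ _ _ (by simp),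
    List.getD_append _ _ _ _ (by simpa [length_encodeVectors] using hlt)]
  exact getD_encodeVectors A i hk

theorem getD_ovInput_right (i : Fin N) {k : ℕ} (hk : k < d) :
    (ovInput A B).getD ((N + i) * d + k + 2) 0 = bits (B i) k := by
  unfold ovInput
  rw [List.getD_append_right _ _ _ _ (by
    simp only [List.length_append, length_encodeVectors, List.length_cons, List.length_nil]
    rw [add_mul]
    omega), ← getD_encodeVectors B i hk]
  congr 1
  simp only [List.length_append, length_encodeVectors, List.length_cons, List.length_nil]
  rw [add_mul]
  omega

theorem bits_le_one {d : ℕ} (a : Fin d → Bool) (k : ℕ) : bits a k ≤ 1 := by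
  unfold bits
  split_ifs
  exacts [Bool.toNat_le _, Nat.zero_le _]

theorem getD_ovInput_le (x : ℕ) : (ovInput A B).getD x 0 ≤ N + d + 1 := by
  have hA : ∀ C : Fin N → Fin d → Bool, ∀ w ∈ encodeVectors C, w ≤ 1 := by
    intro C w hw
    simp only [encodeVectors, List.mem_flatten, List.mem_ofFn] at hw
    obtain ⟨l, ⟨i, rfl⟩, hw⟩ := hw
    obtain ⟨j, rfl⟩ := List.mem_ofFn.1 hw
    exact Bool.toNat_le _
  by_cases hx : x < (ovInput A B).length
  · rw [List.getD_eq_getElem _ _ hx]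
    have hmem := List.getElem_mem hx
    simp only [ovInput, List.mem_append, List.mem_cons, List.not_mem_nil, or_false] at hmem
    rcases hmem with ((h | h) | h) | h
    · exact h.trans_le (by omega)
    · exact h.trans_le (by omega)
    · exact (hA _ _ h).trans (by omega)
    · exact (hA _ _ h).trans (by omega)
  · rw [List.getD_eq_default _ _ (by omega)]
    omega

end

/-! ### Programs for the virtual input -/

/-- Replaces the word `y` in register `1` by `curveWord u v m n row y`, where register `8` holds
the dimension `d`, register `10` the complexity `m`, register `6` the number `n` of curves, and
the vectors are `n` consecutive ones of the orthogonal vectors instance, from the one with the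
number in register `5` on. -/
def curveWordProg (u v : ℕ) : Prog :=
  block [.op .mul 2 10 6, .const 3 3, .op .mul 2 2 3, .op .lt 2 1 2,
    .cond 2
      (block [.op .mod 2 1 3, .const 4 1, .op .eq 4 2 4,
        .cond 4
          (block [.op .div 1 1 3, .op .mod 2 1 10, .op .div 1 1 10, .op .add 1 1 5,
            .const 3 2, .op .div 4 2 3, .op .mod 2 2 3, .op .lt 6 4 8,
            .cond 6 (block [.op .mul 1 1 8, .op .add 1 1 4, .op .add 1 1 3, .read 1 1])
              (.const 1 0),
            .cond 1 (.const 1 u) (.const 1 v),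
            .op .mul 4 4 3, .const 5 3, .op .add 4 4 5,
            .cond 2 (.op .sub 1 4 1) (.op .add 1 4 1)])
          (block [.const 3 2, .op .div 1 2 3])])
      (.const 1 0)]

theorem runs_curveWordProg {u v W m n d st : ℕ} {inp : List ℕ} {row : ℕ → ℕ → ℕ} {σ : State}
    (hu : u ≤ 3) (hv : v ≤ 3)
    (hd : σ.reg 8 = d) (hm : σ.reg 10 = m) (hn : σ.reg 6 = n) (hst : σ.reg 5 = st)
    (hrow : ∀ i < n, ∀ k < d, inp.getD ((st + i) * d + k + 2) 0 = row i k)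
    (hrow0 : ∀ i k, d ≤ k → row i k = 0) (hrow1 : ∀ i k, row i k ≤ 1)
    (hW : m * n * 3 < W) (hW' : (st + n) * d + m + st + n + 10 < W) :
    Runs W inp (curveWordProg u v) σ fun t σ' => t ≤ 60 ∧
      σ'.reg 1 = curveWord u v m n row (σ.reg 1) ∧ σ'.mem = σ.mem ∧
      ∀ r, r = 0 ∨ 7 ≤ r → σ'.reg r = σ.reg r := by
  set y := σ.reg 1 with hy_def
  have hregs : ∀ r, r = 0 ∨ 7 ≤ r → r ≠ 1 ∧ r ≠ 2 ∧ r ≠ 3 ∧ r ≠ 4 ∧ r ≠ 5 ∧ r ≠ 6 := by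
    intro r hr
    omega
  have hmn : m * n ≤ m * n * 3 := by omega
  simp only [curveWordProg, runs_block_cons, runs_block_nil, runs_const, runs_read,
    runs_op, runs_cond, setReg_reg, setReg_mem, BinOp.eval, Nat.reduceEqDiff, if_true, if_false,
    hd, hm, hn, hst, ← hy_def, OfNat.one_ne_ofNat, OfNat.ofNat_ne_one]
  refine ⟨by omega, by omega, hW, by split_ifs <;> omega, ?_⟩
  by_cases h1 : y < m * n * 3
  · simp only [h1, if_true, one_ne_zero, if_false]
    refine ⟨by omega, by omega, by split_ifs <;> omega, ?_⟩
    by_cases h2 : y % 3 = 1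
    · have hm0 : 0 < m := by
        rcases Nat.eq_zero_or_pos m with h | h
        · simp [h] at h1
        · exact h
      have hi : y / 3 / m < n := by
        rw [Nat.div_lt_iff_lt_mul hm0, mul_comm]
        omega
      have hj : y / 3 % m < m := Nat.mod_lt _ hm0
      have hdm := Nat.div_le_self (y / 3) m
      have hval : curveWord u v m n row y = gadgetVertex u v (row (y / 3 / m)) (y / 3 % m) := by
        simp [curveWord, h1, h2]
      rw [hval]
      unfold gadgetVertex
      set i := y / 3 / m with hi_def
      set j := y / 3 % m with hj_def
      have hmul : (st + i) * d + d ≤ (st + n) * d := by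
        rw [← Nat.succ_mul]
        exact Nat.mul_le_mul_right d (by omega)
      simp only [h2, if_true, one_ne_zero, if_false]
      rw [add_comm i st]
      refine ⟨by omega, by omega, by omega, by omega, by omega, by omega, by omega,
        by split_ifs <;> omega, ?_⟩
      by_cases h3 : j / 2 < d
      · simp only [h3, if_true, one_ne_zero, if_false, hrow i hi _ h3]
        have := hrow1 i (j / 2)
        refine ⟨by omega, by omega, by omega, by omega, ?_⟩
        by_cases h4 : row i (j / 2) = 0 <;> by_cases h5 : j % 2 = 0 <;>
        · simp only [h4, h5, if_true, if_false]
          refine ⟨by omega, by omega, by omega, by omega, by omega, by omega, by omega, trivial, ?_⟩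
          intro r hr
          obtain ⟨r1, r2, r3, r4, r5, r6⟩ := hregs r hr
          simp only [r1, r2, r3, r4, r5, r6, if_false]
      · simp only [h3, if_true, if_false, hrow0 i (j / 2) (by omega)]
        refine ⟨by omega, by omega, ?_⟩
        by_cases h5 : j % 2 = 0 <;>
        · simp only [h5, if_true, if_false]
          refine ⟨by omega, by omega, by omega, by omega, by omega, by omega, trivial, ?_⟩
          intro r hr
          obtain ⟨r1, r2, r3, r4, r5, r6⟩ := hregs r hr
          simp only [r1, r2, r3, r4, r5, r6, if_false]
    · simp only [h2, if_true, if_false]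
      refine ⟨by omega, by omega, by omega, ?_, trivial, ?_⟩
      · simp [curveWord, h1, h2]
      · intro r hr
        obtain ⟨r1, r2, r3, r4, r5, r6⟩ := hregs r hr
        simp only [r1, r2, r3, r4, if_false]
  · simp only [h1, if_true, if_false]
    refine ⟨by omega, by omega, ?_, trivial, ?_⟩
    · simp [curveWord, h1]
    · intro r hr
      obtain ⟨r1, r2, r3, r4, r5, r6⟩ := hregs r hr
      simp only [r1, r2, r3, if_false]

/-- Replaces the word `x` in register `1` by word `x` of the input of a query. Register `12` holds
the number of the query vector in the instance. -/
def queryInputProg : Prog :=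
  block [.const 6 1, .const 2 0, .op .add 5 12 2, curveWordProg 0 2]

/-- Replaces the word `x` in register `1` by word `x` of the input of the preprocessing.
Register `9` holds the number of curves, and register `11` the number of the first vector. -/
def preInputProg : Prog :=
  block [.const 2 6, .op .lt 3 1 2,
    .cond 3
      (block [.cond 1
        (block [.const 2 3, .op .lt 3 1 2,
          .cond 3 (block [.const 2 0, .op .add 1 10 2]) (block [.op .lt 1 2 1])])
        (block [.op .add 1 9 1])])
      (block [.op .sub 1 1 2, .const 2 0, .op .add 6 9 2, .op .add 5 11 2, curveWordProg 3 1])]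

theorem readsInput_query {N d W W' m : ℕ} {A B : Fin N → Fin d → Bool} {σ₀ : State} (b : Fin N)
    (h8 : σ₀.reg 8 = d) (h10 : σ₀.reg 10 = m) (h12 : σ₀.reg 12 = N + b) (hWW : W ≤ W')
    (hW : m * 3 < W') (hW' : 2 * N * d + m + 2 * N + 10 < W') :
    ReadsInput W W' (ovInput A B) (encodeCurve (gadgetCurve 0 2 m (bits (B b)))) 70
      queryInputProg σ₀ := by
  intro σ hσ hx
  have hb := b.2
  simp only [queryInputProg, runs_block_cons, runs_block_nil, runs_const,
    runs_op, setReg_reg, BinOp.eval, Nat.reduceEqDiff, if_true, if_false, add_zero,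
    hσ 12 (by omega) (by omega), h12]
  refine ⟨by omega, by omega, by omega, ?_⟩
  have hmul : (N + b + 1) * d ≤ 2 * N * d := Nat.mul_le_mul_right d (by omega)
  refine (runs_curveWordProg (m := m) (n := 1) (d := d) (st := N + b)
    (row := fun _ => bits (B b)) (by omega) (by omega)
    ?_ ?_ ?_ ?_ ?_ ?_ ?_ ?_ ?_).mono ?_
  · simp [setReg_reg, hσ 8, h8]
  · simp [setReg_reg, hσ 10, h10]
  · simp [setReg_reg]
  · simp [setReg_reg]
  · intro i hi k hk
    obtain rfl : i = 0 := by omega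
    exact getD_ovInput_right A B b hk
  · intro i k hk
    simp [bits, not_lt.2 hk]
  · intro i k
    exact bits_le_one _ _
  · omega
  · omega
  · rintro t σ' ⟨ht, h1, hm, hr⟩
    refine ⟨by omega, ?_, hm, fun r hr' => ?_⟩
    · rw [h1, getD_encodeCurve]
      simp [setReg_reg]
    · rw [hr r hr']
      simp only [setReg_reg, show r ≠ 5 by omega, show r ≠ 6 by omega, show r ≠ 2 by omega,
        if_false]

theorem readsInput_pre {N d n W W' m st : ℕ} {A B : Fin N → Fin d → Bool} {σ₀ : State}
    (h8 : σ₀.reg 8 = d) (h9 : σ₀.reg 9 = n) (h10 : σ₀.reg 10 = m) (h11 : σ₀.reg 11 = st)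
    (hst : st + n ≤ N) (hm0 : 0 < m) (hWW : W ≤ W')
    (hW : m * n * 3 < W') (hW' : 2 * N * d + m + 2 * N + 10 < W') :
    ReadsInput W W' (ovInput A B) (annInput m 1 fun i : Fin n =>
      gadgetCurve 3 1 m (bits (A ⟨st + i, by omega⟩))) 80 preInputProg σ₀ := by
  intro σ hσ hx
  have hrow : (annInput m 1 fun i : Fin n => gadgetCurve 3 1 m (bits (A ⟨st + i, by omega⟩))) =
      annInput m 1 fun i : Fin n => gadgetCurve 3 1 m
        ((fun i k => if h : i < n then bits (A ⟨st + i, by omega⟩) k else 0 : ℕ → ℕ → ℕ) i) := by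
    simp
  rw [hrow, getD_annInput hm0
    (fun i k => if h : i < n then bits (A ⟨st + i, by omega⟩) k else 0)]
  set x := σ.reg 1 with hx_def
  simp only [preInputProg, runs_block_cons, runs_block_nil, runs_const, runs_cond,
    runs_op, setReg_reg, BinOp.eval, Nat.reduceEqDiff, if_true, if_false, add_zero,
    hσ 9 (by omega) (by omega), h9, hσ 10 (by omega) (by omega), h10,
    hσ 11 (by omega) (by omega), h11, ← hx_def, OfNat.one_ne_ofNat, OfNat.ofNat_ne_one]
  refine ⟨by omega, by split_ifs <;> omega, ?_⟩
  by_cases h6 : x < 6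
  · simp only [h6, if_true, one_ne_zero, if_false]
    have hregs : ∀ r, r = 0 ∨ 7 ≤ r → r ≠ 1 ∧ r ≠ 2 ∧ r ≠ 3 := by
      intro r hr
      omega
    by_cases hx0 : x = 0
    · simp only [hx0, if_true]
      refine ⟨by omega, by omega, by omega, rfl, fun r hr => ?_⟩
      obtain ⟨r1, r2, r3⟩ := hregs r hr
      simp only [r1, r2, r3, if_false]
    · simp only [hx0, if_false]
      refine ⟨by omega, by split_ifs <;> omega, ?_⟩
      by_cases hx3 : x < 3
      · simp only [hx3, if_true, one_ne_zero, if_false]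
        refine ⟨by omega, by omega, by omega, trivial, rfl, fun r hr => ?_⟩
        obtain ⟨r1, r2, r3⟩ := hregs r hr
        simp only [r1, r2, r3, if_false]
      · simp only [hx3, if_true, if_false]
        refine ⟨by split_ifs <;> omega, by omega, by split_ifs <;> omega, rfl, fun r hr => ?_⟩
        obtain ⟨r1, r2, r3⟩ := hregs r hr
        simp only [r1, r2, r3, if_false]
  · simp only [h6, if_true, if_false]
    have hn : n ≤ m * n * 3 := by nlinarith
    refine ⟨by omega, by omega, by omega, by omega, ?_⟩
    have hmul : (st + n) * d ≤ 2 * N * d := Nat.mul_le_mul_right d (by omega)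
    refine (runs_curveWordProg (m := m) (n := n) (d := d) (st := st)
      (row := fun i k => if h : i < n then bits (A ⟨st + i, by omega⟩) k else 0)
      (by omega) (by omega) ?_ ?_ ?_ ?_ ?_ ?_ ?_ ?_ ?_).mono ?_
    · simp [setReg_reg, hσ 8, h8]
    · simp [setReg_reg, hσ 10, h10]
    · simp [setReg_reg]
    · simp [setReg_reg]
    · intro i hi k hk
      rw [dif_pos hi]
      exact getD_ovInput_left A B ⟨st + i, by omega⟩ hk
    · intro i k hk
      simp [bits, not_lt.2 hk]
    · intro i k
      split_ifs
      exacts [bits_le_one _ _, by omega]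
    · omega
    · omega
    · rintro t σ' ⟨ht, h1, hm, hr⟩
      refine ⟨by omega, ?_, hm, fun r hr' => ?_⟩
      · rw [h1]
        simp [setReg_reg]
      · rw [hr r hr']
        simp only [setReg_reg, show r ≠ 5 by omega, show r ≠ 6 by omega, show r ≠ 2 by omega,
          show r ≠ 1 by omega, show r ≠ 3 by omega, if_false]

/-! ### Running the data structure on all groups of vectors -/

/-- Simulates the query with the next vector of the second set. Register `17` counts down the
queries that are left, and register `0` is set to `1` if a curve is found. A new query stamp, in
register `16`, discards what earlier queries have written. -/
def queryRound (qry : Prog) (R : ℕ) : Prog :=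
  block [.const 18 1, .op .sub 17 17 18, .op .add 12 7 17, .op .add 16 16 18,
    .const 1 0, .op .add 13 16 1, .op .add 14 15 1, clearRegs R,
    simulate queryInputProg 2 0 qry, .cond 20 (.const 0 1) .skip]

/-- Simulates the preprocessing for the `n` vectors of the first set that precede those treated so
far, and then all queries. Register `11` holds the number of the first vector of the group; since
subtraction is truncated, the final group may overlap the previous one. A new group stamp, in
register `15`, discards the memory of earlier groups. Memory layer `4` is never written. -/
def groupRound (pre qry : Prog) (R : ℕ) : Prog :=
  block [.op .sub 11 11 9, .const 18 1, .op .add 15 15 18, .const 1 0, .op .add 13 15 1,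
    .const 14 0, clearRegs R, simulate preInputProg 0 4 pre,
    .const 1 0, .op .add 17 7 1, .loop 17 (queryRound qry R)]

/-- The parameters are in the registers, and all stamps in the memory are at most the current
ones. -/
structure Ready (W' N d n m : ℕ) (σ : State) : Prop where
  reg7 : σ.reg 7 = N
  reg8 : σ.reg 8 = d
  reg9 : σ.reg 9 = n
  reg10 : σ.reg 10 = m
  mem_lt : ∀ y, σ.mem y < W'
  group_stamp : ∀ x, σ.mem (6 * x) ≤ σ.reg 15
  query_stamp : ∀ x, σ.mem (6 * x + 2) ≤ σ.reg 16
  unused : ∀ x, σ.mem (6 * x + 5) = 0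

theorem simulates_start {W W' R up low : ℕ} {σ : State} {M : ℕ → ℕ} (hW : 0 < W)
    (hreg : ∀ r < R, σ.reg (r + 20) = 0) (hlt : ∀ y, σ.mem y < W')
    (hstamp : ∀ x, σ.mem (6 * x + up) < σ.reg 13)
    (hM : ∀ x, M x = layer low (σ.reg 14) (fun _ => 0) σ.mem x) :
    Simulates W W' R up low σ (State.start M) σ where
  reg r hr := hreg r hr
  reg_lt _ := hW
  control _ _ _ := rfl
  mem x := by
    rw [layer, if_neg (hstamp x).ne]
    exact hM x
  frame _ _ _ := rfl
  mem_lt := hlt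
  stamp _ := Or.inl rfl

section

variable {N d n m W W' R Tp Tq : ℕ} {A B : Fin N → Fin d → Bool} {pre qry : Prog}

theorem runs_queryRound (hm : 0 < m) (hWpos : 0 < W) (hWW : 6 * W + 6 < W') (h1 : m * 3 < W')
    (h2 : 2 * N * d + m + 2 * N + 10 < W') (hR : 1 ≤ R) (hqry : RegsLt R qry)
    {G : Fin N → Prop} {M : ℕ → ℕ}
    (hq : ∀ b : Fin N, ∃ t s, Exec W (encodeCurve (gadgetCurve 0 2 m (bits (B b)))) qry
      (State.start M) t s ∧ t ≤ Tq ∧ (s.reg 0 ≠ 0 ↔ G b))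
    {σ : State} (hσ : Ready W' N d n m σ) (b : Fin N) (h17 : σ.reg 17 = b + 1)
    (h15 : σ.reg 15 < W') (h16 : σ.reg 16 + 1 < W')
    (hM : ∀ x, M x = layer 0 (σ.reg 15) (fun _ => 0) σ.mem x) :
    Runs W' (ovInput A B) (queryRound qry R) σ fun t σ' => t ≤ 100 * Tq + R + 20 ∧
      Ready W' N d n m σ' ∧ (∀ x, M x = layer 0 (σ'.reg 15) (fun _ => 0) σ'.mem x) ∧
      σ'.reg 17 = b ∧ σ'.reg 11 = σ.reg 11 ∧ σ'.reg 15 = σ.reg 15 ∧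
      σ'.reg 16 = σ.reg 16 + 1 ∧ (σ'.reg 0 ≠ 0 ↔ σ.reg 0 ≠ 0 ∨ G b) := by
  have hb := b.2
  simp only [queryRound, runs_block_cons, runs_block_nil, runs_const, runs_op, setReg_reg,
    BinOp.eval, Nat.reduceEqDiff, if_true, if_false, hσ.reg7, h17, add_zero,
    OfNat.one_ne_ofNat, OfNat.ofNat_ne_one, Nat.add_sub_cancel]
  refine ⟨by omega, by omega, by omega, by omega, by omega, by omega, by omega, ?_⟩
  refine (runs_clearRegs (by omega) _ R _).mono ?_
  rintro t₁ σ₁ ⟨ht₁, hm₁, hc₁, hr₁⟩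
  simp only [setReg_mem] at hm₁
  obtain ⟨t, s, he, ht, hs⟩ := hq b
  have c0 : σ₁.reg 0 = σ.reg 0 := by rw [hc₁ 0 (by omega)]; simp [setReg_reg]
  have c7 : σ₁.reg 7 = N := by rw [hc₁ 7 (by omega)]; simp [setReg_reg, hσ.reg7]
  have c8 : σ₁.reg 8 = d := by rw [hc₁ 8 (by omega)]; simp [setReg_reg, hσ.reg8]
  have c9 : σ₁.reg 9 = n := by rw [hc₁ 9 (by omega)]; simp [setReg_reg, hσ.reg9]
  have c10 : σ₁.reg 10 = m := by rw [hc₁ 10 (by omega)]; simp [setReg_reg, hσ.reg10]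
  have c11 : σ₁.reg 11 = σ.reg 11 := by rw [hc₁ 11 (by omega)]; simp [setReg_reg]
  have c12 : σ₁.reg 12 = N + b := by rw [hc₁ 12 (by omega)]; simp [setReg_reg]
  have c13 : σ₁.reg 13 = σ.reg 16 + 1 := by rw [hc₁ 13 (by omega)]; simp [setReg_reg]
  have c14 : σ₁.reg 14 = σ.reg 15 := by rw [hc₁ 14 (by omega)]; simp [setReg_reg]
  have c15 : σ₁.reg 15 = σ.reg 15 := by rw [hc₁ 15 (by omega)]; simp [setReg_reg]
  have c16 : σ₁.reg 16 = σ.reg 16 + 1 := by rw [hc₁ 16 (by omega)]; simp [setReg_reg]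
  have c17 : σ₁.reg 17 = b := by rw [hc₁ 17 (by omega)]; simp [setReg_reg]
  have hsim : Simulates W W' R 2 0 σ₁ (State.start M) σ₁ := by
    refine simulates_start hWpos hr₁ (by rw [hm₁]; exact hσ.mem_lt) (fun x => ?_) (fun x => ?_)
    · rw [hm₁, c13]
      exact Nat.lt_succ_of_le (hσ.query_stamp x)
    · rw [hm₁, c14]
      exact hM x
  refine (exec_simulate hWW (by omega) (by omega) (by omega) (by omega) (by omega) (by omega)
    (readsInput_query b c8 c10 c12 (by omega) h1 h2) he hqry hsim).mono ?_
  rintro t₂ σ₂ ⟨ht₂, h₂⟩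
  have k := h₂.control
  have ht₂' : t₂ ≤ 100 * Tq := ht₂.trans (Nat.mul_le_mul_left _ ht)
  have h20 : σ₂.reg 20 = s.reg 0 := h₂.reg 0 hR
  have hready : Ready W' N d n m σ₂ := by
    refine ⟨?_, ?_, ?_, ?_, h₂.mem_lt, fun x => ?_, fun x => ?_, fun x => ?_⟩
    · rw [k 7 (by omega) (by omega), c7]
    · rw [k 8 (by omega) (by omega), c8]
    · rw [k 9 (by omega) (by omega), c9]
    · rw [k 10 (by omega) (by omega), c10]
    · rw [k 15 (by omega) (by omega), c15, h₂.frame _ (by omega) (by omega), hm₁]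
      exact hσ.group_stamp x
    · rw [k 16 (by omega) (by omega), c16]
      have := hσ.query_stamp x
      rcases h₂.stamp x with h | h
      · rw [h, hm₁]
        omega
      · rw [h, c13]
    · rw [h₂.frame _ (by omega) (by omega), hm₁]
      exact hσ.unused x
  have hlayer : ∀ x, M x = layer 0 (σ.reg 15) (fun _ => 0) σ₂.mem x := by
    intro x
    rw [hM, layer, layer, h₂.frame _ (by omega) (by omega), h₂.frame _ (by omega) (by omega), hm₁]
  have k0 : σ₂.reg 0 = σ.reg 0 := by rw [k 0 (by omega) (by omega), c0]
  have k11 : σ₂.reg 11 = σ.reg 11 := by rw [k 11 (by omega) (by omega), c11]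
  have k15 : σ₂.reg 15 = σ.reg 15 := by rw [k 15 (by omega) (by omega), c15]
  have k16 : σ₂.reg 16 = σ.reg 16 + 1 := by rw [k 16 (by omega) (by omega), c16]
  have k17 : σ₂.reg 17 = b := by rw [k 17 (by omega) (by omega), c17]
  rw [runs_cond, h20]
  split_ifs with hs0
  · refine runs_skip.2 ⟨by omega, hready, by rwa [k15], k17, k11, k15, k16, ?_⟩
    rw [k0, ← hs]
    simp [hs0]
  · refine runs_const.2 ⟨by omega, by omega, ?_, ?_, ?_, ?_, ?_, ?_, ?_⟩
    · exact ⟨hready.1, hready.2, hready.3, hready.4, hready.5, hready.6, hready.7, hready.8⟩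
    · simpa [setReg_reg, setReg_mem, k15] using hlayer
    · simpa [setReg_reg] using k17
    · simpa [setReg_reg] using k11
    · simpa [setReg_reg] using k15
    · simpa [setReg_reg] using k16
    · simp [setReg_reg, hs.1 hs0]

theorem runs_queryLoop (hm : 0 < m) (hWpos : 0 < W) (hWW : 6 * W + 6 < W') (h1 : m * 3 < W')
    (h2 : 2 * N * d + m + 2 * N + 10 < W') (hR : 1 ≤ R) (hqry : RegsLt R qry)
    {G : Fin N → Prop} {M : ℕ → ℕ}
    (hq : ∀ b : Fin N, ∃ t s, Exec W (encodeCurve (gadgetCurve 0 2 m (bits (B b)))) qry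
      (State.start M) t s ∧ t ≤ Tq ∧ (s.reg 0 ≠ 0 ↔ G b))
    {σ : State} (hσ : Ready W' N d n m σ) (h17 : σ.reg 17 = N)
    (h15 : σ.reg 15 < W') (h16 : σ.reg 16 + N < W')
    (hM : ∀ x, M x = layer 0 (σ.reg 15) (fun _ => 0) σ.mem x) :
    Runs W' (ovInput A B) (.loop 17 (queryRound qry R)) σ fun t σ' =>
      t ≤ N * (100 * Tq + R + 21) + 1 ∧ Ready W' N d n m σ' ∧ σ'.reg 11 = σ.reg 11 ∧
      σ'.reg 15 = σ.reg 15 ∧ σ'.reg 16 = σ.reg 16 + N ∧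
      (σ'.reg 0 ≠ 0 ↔ σ.reg 0 ≠ 0 ∨ ∃ b, G b) := by
  refine (runs_loop (fun k τ => k ≤ N ∧ τ.reg 17 = k ∧ Ready W' N d n m τ ∧
      (∀ x, M x = layer 0 (τ.reg 15) (fun _ => 0) τ.mem x) ∧ τ.reg 11 = σ.reg 11 ∧
      τ.reg 15 = σ.reg 15 ∧ τ.reg 16 = σ.reg 16 + (N - k) ∧
      (τ.reg 0 ≠ 0 ↔ σ.reg 0 ≠ 0 ∨ ∃ b : Fin N, k ≤ b ∧ G b)) (100 * Tq + R + 20)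
    ?_ (k := N) ⟨le_rfl, h17, hσ, hM, rfl, rfl, by omega, ?_⟩).mono ?_
  · rintro k τ ⟨hk, hk17, hτ, hMτ, hτ11, hτ15, hτ16, hτ0⟩ hne
    refine ⟨k - 1, by omega, ?_⟩
    refine (runs_queryRound hm hWpos hWW h1 h2 hR hqry hq hτ ⟨k - 1, by omega⟩
      (by simp only; omega) (by omega) (by omega) hMτ).mono ?_
    rintro t τ' ⟨ht, hτ', hM', h17', h11', h15', h16', h0'⟩
    have h16 : τ'.reg 16 = σ.reg 16 + (N - (k - 1)) := by
      clear h0' hτ0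
      omega
    refine ⟨ht, (Nat.sub_le k 1).trans hk, h17', hτ', hM', h11'.trans hτ11, h15'.trans hτ15, h16,
      ?_⟩
    rw [h0', hτ0, or_assoc]
    refine or_congr Iff.rfl ⟨?_, ?_⟩
    · rintro (⟨b, hb, hG⟩ | hG)
      · exact ⟨b, by omega, hG⟩
      · exact ⟨_, le_rfl, hG⟩
    · rintro ⟨b, hb, hG⟩
      rcases Nat.lt_or_ge b k with h | h
      · right
        rwa [show (⟨k - 1, by omega⟩ : Fin N) = b from Fin.ext (by simp only; omega)]
      · exact Or.inl ⟨b, h, hG⟩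
  · have : ¬ ∃ b : Fin N, N ≤ b ∧ G b := by
      rintro ⟨b, hb, -⟩
      have := b.2
      omega
    simp [this]
  · rintro t τ ⟨ht, h0, k, hk, hk17, hτ, -, hτ11, hτ15, hτ16, hτ0⟩
    obtain rfl : k = 0 := by omega
    exact ⟨ht, hτ, hτ11, hτ15, hτ16, by simpa using hτ0⟩

/-- On the word RAM with word bound `W`, the programs `pre` and `qry` find orthogonal pairs between
any `n` consecutive vectors of `A` and any vector of `B`, where the preprocessing takes at most
`Tp` and a query at most `Tq` steps. -/
def AnswersGroups (W n m Tp Tq : ℕ) (A B : Fin N → Fin d → Bool) (pre qry : Prog) : Prop :=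
  ∀ (st : ℕ) (hst : st + n ≤ N), ∃ t s,
    Exec W (annInput m 1 fun i : Fin n => gadgetCurve 3 1 m (bits (A ⟨st + i, by omega⟩))) pre
      (State.start fun _ => 0) t s ∧ t ≤ Tp ∧
    ∀ b : Fin N, ∃ t' s', Exec W (encodeCurve (gadgetCurve 0 2 m (bits (B b)))) qry
      (State.start s.mem) t' s' ∧ t' ≤ Tq ∧
      (s'.reg 0 ≠ 0 ↔ ∃ i : Fin n, Orthogonal (A ⟨st + i, by omega⟩) (B b))

theorem runs_groupRound (hm : 0 < m) (hn : 0 < n) (hnN : n ≤ N) (hWpos : 0 < W)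
    (hWW : 6 * W + 6 < W') (h1 : m * n * 3 < W') (h2 : 2 * N * d + m + 2 * N + 10 < W')
    (hR : 1 ≤ R) (hpre : RegsLt R pre) (hqry : RegsLt R qry)
    (h : AnswersGroups W n m Tp Tq A B pre qry)
    {σ : State} (hσ : Ready W' N d n m σ) (h11 : σ.reg 11 ≤ N)
    (h15 : σ.reg 15 + 1 < W') (h16 : σ.reg 16 + N < W') :
    Runs W' (ovInput A B) (groupRound pre qry R) σ fun t σ' =>
      t ≤ 110 * Tp + R + N * (100 * Tq + R + 21) + 20 ∧
      Ready W' N d n m σ' ∧ σ'.reg 11 = σ.reg 11 - n ∧ σ'.reg 15 = σ.reg 15 + 1 ∧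
      σ'.reg 16 = σ.reg 16 + N ∧
      (σ'.reg 0 ≠ 0 ↔ σ.reg 0 ≠ 0 ∨
        ∃ i j : Fin N, σ.reg 11 - n ≤ i ∧ (i : ℕ) < σ.reg 11 - n + n ∧
          Orthogonal (A i) (B j)) := by
  simp only [groupRound, runs_block_cons, runs_block_nil, runs_const, runs_op, setReg_reg,
    BinOp.eval, Nat.reduceEqDiff, if_true, if_false, hσ.reg9, add_zero,
    OfNat.ofNat_ne_one]
  refine ⟨by omega, by omega, by omega, by omega, by omega, by omega, ?_⟩
  refine (runs_clearRegs (by omega) _ R _).mono ?_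
  rintro t₁ σ₁ ⟨ht₁, hm₁, hc₁, hr₁⟩
  simp only [setReg_mem] at hm₁
  set st := σ.reg 11 - n with hst_def
  have hst : st + n ≤ N := by omega
  obtain ⟨t, s, he, ht, hq⟩ := h st hst
  have c0 : σ₁.reg 0 = σ.reg 0 := by rw [hc₁ 0 (by omega)]; simp [setReg_reg]
  have c7 : σ₁.reg 7 = N := by rw [hc₁ 7 (by omega)]; simp [setReg_reg, hσ.reg7]
  have c8 : σ₁.reg 8 = d := by rw [hc₁ 8 (by omega)]; simp [setReg_reg, hσ.reg8]
  have c9 : σ₁.reg 9 = n := by rw [hc₁ 9 (by omega)]; simp [setReg_reg, hσ.reg9]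
  have c10 : σ₁.reg 10 = m := by rw [hc₁ 10 (by omega)]; simp [setReg_reg, hσ.reg10]
  have c11 : σ₁.reg 11 = st := by rw [hc₁ 11 (by omega)]; simp [setReg_reg]
  have c13 : σ₁.reg 13 = σ.reg 15 + 1 := by rw [hc₁ 13 (by omega)]; simp [setReg_reg]
  have c15 : σ₁.reg 15 = σ.reg 15 + 1 := by rw [hc₁ 15 (by omega)]; simp [setReg_reg]
  have c16 : σ₁.reg 16 = σ.reg 16 := by rw [hc₁ 16 (by omega)]; simp [setReg_reg]
  have hzero : ∀ x, (0 : ℕ) = layer 4 (σ₁.reg 14) (fun _ => 0) σ₁.mem x := by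
    intro x
    unfold layer
    rw [hm₁, show 6 * x + 4 + 1 = 6 * x + 5 by rfl, hσ.unused x]
    simp
  have hsim : Simulates W W' R 0 4 σ₁ (State.start fun _ => 0) σ₁ := by
    refine simulates_start hWpos hr₁ (by rw [hm₁]; exact hσ.mem_lt) (fun x => ?_) hzero
    rw [hm₁, c13]
    exact Nat.lt_succ_of_le (hσ.group_stamp x)
  refine (exec_simulate hWW (by omega) (by omega) (by omega) (by omega) (by omega) (by omega)
    (readsInput_pre c8 c9 c10 c11 hst hm (by omega) h1 h2) he hpre hsim).mono ?_
  rintro t₂ σ₂ ⟨ht₂, h₂⟩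
  have k := h₂.control
  have ht₂' : t₂ ≤ 110 * Tp := ht₂.trans (Nat.mul_le_mul_left _ ht)
  have k7 : σ₂.reg 7 = N := by rw [k 7 (by omega) (by omega), c7]
  have k0 : σ₂.reg 0 = σ.reg 0 := by rw [k 0 (by omega) (by omega), c0]
  have k11 : σ₂.reg 11 = st := by rw [k 11 (by omega) (by omega), c11]
  have k15 : σ₂.reg 15 = σ.reg 15 + 1 := by rw [k 15 (by omega) (by omega), c15]
  have k16 : σ₂.reg 16 = σ.reg 16 := by rw [k 16 (by omega) (by omega), c16]
  refine ⟨by omega, by omega, ?_⟩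
  rw [k7]
  set σ₃ := (σ₂.setReg 1 0).setReg 17 N with hσ₃
  have hready : Ready W' N d n m σ₃ := by
    refine ⟨?_, ?_, ?_, ?_, h₂.mem_lt, fun x => ?_, fun x => ?_, fun x => ?_⟩
    · simpa [hσ₃, setReg_reg] using k7
    · simp [hσ₃, setReg_reg, k 8 (by omega) (by omega), c8]
    · simp [hσ₃, setReg_reg, k 9 (by omega) (by omega), c9]
    · simp [hσ₃, setReg_reg, k 10 (by omega) (by omega), c10]
    · simp only [hσ₃, setReg_reg, setReg_mem, Nat.reduceEqDiff, if_false, OfNat.ofNat_ne_one, k15]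
      have := hσ.group_stamp x
      rcases h₂.stamp x with h | h
      · rw [hm₁] at h
        simp only [add_zero] at h
        omega
      · simp only [add_zero] at h
        omega
    · simp only [hσ₃, setReg_reg, setReg_mem, Nat.reduceEqDiff, if_false, OfNat.ofNat_ne_one, k16]
      rw [h₂.frame _ (by omega) (by omega), hm₁]
      exact hσ.query_stamp x
    · simp only [hσ₃, setReg_mem]
      rw [h₂.frame _ (by omega) (by omega), hm₁]
      exact hσ.unused x
  have r0 : σ₃.reg 0 = σ.reg 0 := by simp [hσ₃, setReg_reg, k0]
  have r11 : σ₃.reg 11 = st := by simp [hσ₃, setReg_reg, k11]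
  have r15 : σ₃.reg 15 = σ.reg 15 + 1 := by simp [hσ₃, setReg_reg, k15]
  have r16 : σ₃.reg 16 = σ.reg 16 := by simp [hσ₃, setReg_reg, k16]
  have hm3 : m * 3 < W' := by
    have : m * 3 ≤ m * n * 3 := by
      have := Nat.le_mul_of_pos_right m hn
      omega
    omega
  refine (runs_queryLoop hm hWpos hWW hm3 h2 hR hqry hq hready (by simp [hσ₃, setReg_reg])
    (by omega) (by omega) (fun x => ?_)).mono ?_
  · rw [h₂.mem x, ← show (fun _ => 0) = layer 4 (σ₁.reg 14) (fun _ => 0) σ₁.mem from funext hzero,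
      c13, r15]
    rfl
  · rintro t₃ σ₄ ⟨ht₃, hσ₄, h11₄, h15₄, h16₄, h0₄⟩
    refine ⟨by omega, hσ₄, by omega, by omega, by omega, ?_⟩
    rw [h0₄, r0]
    refine or_congr Iff.rfl ⟨?_, ?_⟩
    · rintro ⟨b, i, hi⟩
      exact ⟨⟨st + i, by omega⟩, b, by simp, by simp, hi⟩
    · rintro ⟨i, j, hi, hi', ho⟩
      refine ⟨j, ⟨i - st, by omega⟩, ?_⟩
      rwa [show (⟨st + (i - st), by omega⟩ : Fin N) = i from Fin.ext (by simp only; omega)]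

/-- The groups are treated one after the other, until register `11` is `0`. -/
theorem runs_groupLoop (hm : 0 < m) (hn : 0 < n) (hnN : n ≤ N) (hWpos : 0 < W)
    (hWW : 6 * W + 6 < W') (h1 : m * n * 3 < W') (h2 : 2 * N * d + m + 2 * N + 10 < W')
    (h3 : (N / n + 1) * (N + 1) < W')
    (hR : 1 ≤ R) (hpre : RegsLt R pre) (hqry : RegsLt R qry)
    (h : AnswersGroups W n m Tp Tq A B pre qry)
    {σ : State} (hσ : Ready W' N d n m σ) (h11 : σ.reg 11 = N)
    (h15 : σ.reg 15 = 0) (h16 : σ.reg 16 = 0) (h0 : σ.reg 0 = 0) :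
    Runs W' (ovInput A B) (.loop 11 (groupRound pre qry R)) σ fun t σ' =>
      t ≤ (N / n + 1) * (110 * Tp + R + N * (100 * Tq + R + 21) + 21) + 1 ∧
      (σ'.reg 0 ≠ 0 ↔ ∃ i j, Orthogonal (A i) (B j)) := by
  set g := N / n + 1 with hg
  have hgn : N ≤ g * n := by
    rw [hg, mul_comm]
    exact (Nat.lt_mul_div_succ N hn).le
  refine (runs_loop (fun k τ => k ≤ g ∧ Ready W' N d n m τ ∧ τ.reg 11 ≤ N ∧ τ.reg 11 ≤ k * n ∧
      τ.reg 15 = g - k ∧ τ.reg 16 = (g - k) * N ∧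
      (τ.reg 0 ≠ 0 ↔ ∃ i j : Fin N, τ.reg 11 ≤ i ∧ Orthogonal (A i) (B j)))
    (110 * Tp + R + N * (100 * Tq + R + 21) + 20) ?_ (k := g)
    ⟨le_rfl, hσ, h11.le, by omega, by omega, by simpa using h16, ?_⟩).mono ?_
  · rintro k τ ⟨hk, hτ, hτN, hτk, hτ15, hτ16, hτ0⟩ hne
    have hk0 : k ≠ 0 := by
      rintro rfl
      omega
    obtain ⟨k, rfl⟩ := Nat.exists_eq_succ_of_ne_zero hk0
    rw [Nat.succ_eq_add_one] at *
    have hgk : (g - (k + 1)) * N + N = (g - k) * N := by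
      rw [← Nat.succ_mul]
      congr 1
      omega
    have hgk' : (g - k) * N + (g - k) ≤ g * (N + 1) := by
      rw [← Nat.mul_succ]
      exact Nat.mul_le_mul_right _ (by omega)
    refine ⟨k, rfl, ?_⟩
    refine (runs_groupRound hm hn hnN hWpos hWW h1 h2 hR hpre hqry h hτ hτN
      (by omega) (by omega)).mono ?_
    rintro t τ' ⟨ht, hτ', h11', h15', h16', h0'⟩
    rw [Nat.succ_mul] at hτk
    have hle : k ≤ g ∧ τ'.reg 11 ≤ N ∧ τ'.reg 11 ≤ k * n ∧ τ'.reg 15 = g - k ∧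
        τ'.reg 16 = (g - k) * N := by
      clear h0' hτ0
      refine ⟨?_, ?_, ?_, ?_, ?_⟩ <;> omega
    refine ⟨ht, hle.1, hτ', hle.2.1, hle.2.2.1, hle.2.2.2.1, hle.2.2.2.2, ?_⟩
    rw [h0', hτ0, h11']
    constructor
    · rintro (⟨i, j, hi, ho⟩ | ⟨i, j, hi, -, ho⟩)
      exacts [⟨i, j, by omega, ho⟩, ⟨i, j, hi, ho⟩]
    · rintro ⟨i, j, hi, ho⟩
      rcases Nat.lt_or_ge i (τ.reg 11) with hlt | hge
      exacts [Or.inr ⟨i, j, hi, by omega, ho⟩, Or.inl ⟨i, j, hge, ho⟩]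
  · rw [h0, h11]
    simp
  · rintro t τ ⟨ht, hτ11, k, -, -, -, -, -, -, hτ0⟩
    refine ⟨ht, hτ0.trans ?_⟩
    simp [hτ11]

end

/-! ### The algorithm for orthogonal vectors -/

/-- One step in the search for the largest `r` such that `2 ^ (M * r)` is at most `N`. The registers
`1`, `9` and `10` hold `2 ^ (M * r)`, `2 ^ r` and `r`; register `3` holds `2 ^ M`. -/
def powerRound : Prog :=
  block [.op .mul 1 1 3, .op .mul 9 9 5, .op .add 10 10 6, .op .mul 4 1 3, .op .lt 2 7 4,
    .op .sub 2 6 2]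

theorem runs_powerLoop {W M N : ℕ} {inp : List ℕ} {σ : State} (hM : 1 ≤ M) (hN : 1 ≤ N)
    (hW : 2 ^ M * N < W) (h1 : σ.reg 1 = 1)
    (h2 : σ.reg 2 = 1 - if N < 2 ^ M then 1 else 0) (h3 : σ.reg 3 = 2 ^ M) (h5 : σ.reg 5 = 2)
    (h6 : σ.reg 6 = 1) (h7 : σ.reg 7 = N) (h9 : σ.reg 9 = 1) (h10 : σ.reg 10 = 0) :
    Runs W inp (.loop 2 powerRound) σ fun t σ' => t ≤ N * 21 + 1 ∧
      (∃ r, σ'.reg 9 = 2 ^ r ∧ σ'.reg 10 = r ∧ (2 ^ M) ^ r ≤ N ∧ N < (2 ^ M) ^ (r + 1)) ∧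
      σ'.mem = σ.mem ∧ ∀ x, x = 0 ∨ x = 7 ∨ x = 8 ∨ x = 15 ∨ x = 16 → σ'.reg x = σ.reg x := by
  refine (runs_loop (fun k τ => ∃ r, r + k = N ∧ τ.reg 9 = 2 ^ r ∧ τ.reg 10 = r ∧
      τ.reg 1 = (2 ^ M) ^ r ∧ (2 ^ M) ^ r ≤ N ∧
      (τ.reg 2 = 1 - if N < (2 ^ M) ^ (r + 1) then 1 else 0) ∧
      τ.reg 3 = 2 ^ M ∧ τ.reg 5 = 2 ∧ τ.reg 6 = 1 ∧ τ.reg 7 = N ∧ τ.mem = σ.mem ∧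
      ∀ x, x = 0 ∨ x = 7 ∨ x = 8 ∨ x = 15 ∨ x = 16 → τ.reg x = σ.reg x) 20 ?_ (k := N)
    ⟨0, by omega, by simpa using h9, h10, by simpa using h1, by simpa using hN, by simpa using h2,
      h3, h5, h6, h7, rfl, fun _ _ => rfl⟩).mono ?_
  · rintro k τ ⟨r, hr, t9, t10, t1, hrN, t2, t3, t5, t6, t7, hmem, hreg⟩ hne
    have hr1 : (2 ^ M) ^ (r + 1) ≤ N := by
      by_contra hcon
      exact hne (by rw [t2, if_pos (not_le.1 hcon)])
    have h2M : 2 ≤ 2 ^ M := Nat.le_self_pow (by omega) 2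
    have hpow : 2 ^ (r + 1) ≤ (2 ^ M) ^ (r + 1) := Nat.pow_le_pow_left h2M _
    have hlt : r + 1 < 2 ^ (r + 1) := Nat.lt_two_pow_self
    have hmul : (2 ^ M) ^ (r + 1) * 2 ^ M < W := by
      rw [mul_comm]
      exact (Nat.mul_le_mul_left _ hr1).trans_lt hW
    have hNW : N < W := (Nat.le_mul_of_pos_left N (by positivity)).trans_lt hW
    refine ⟨k - 1, by omega, ?_⟩
    simp only [powerRound, runs_block_cons, runs_block_nil, runs_op, setReg_reg, BinOp.eval,
      Nat.reduceEqDiff, if_true, if_false, t1, t3, t5, t6, t7, t9, t10,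
      OfNat.one_ne_ofNat, OfNat.ofNat_ne_one, ← pow_succ]
    rw [← pow_succ] at hmul
    refine ⟨by omega, by omega, by omega, hmul, by split_ifs <;> omega, by omega, by omega,
      r + 1, by omega, rfl, rfl, rfl, hr1, rfl, trivial, trivial, trivial, trivial,
      hmem, ?_⟩
    intro x hx
    simp only [show x ≠ 1 by omega, show x ≠ 2 by omega, show x ≠ 4 by omega,
      show x ≠ 9 by omega, show x ≠ 10 by omega, if_false]
    exact hreg x hx
  · rintro t τ ⟨ht, h0, k, r, hr, t9, t10, t1, hrN, t2, -, -, -, -, hmem, hreg⟩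
    refine ⟨ht, ⟨r, t9, t10, hrN, ?_⟩, hmem, hreg⟩
    by_contra hcon
    rw [t2, if_neg hcon] at h0
    omega

/-- The whole reduction. For small instances, with groups of fewer than `8` vectors, it uses the
program `table`. -/
def reduction (M c R : ℕ) (table pre qry : Prog) : Prog :=
  block [.const 1 0, .read 7 1, .const 6 1, .read 8 6, .const 9 1, .const 10 0, .const 3 (2 ^ M),
    .const 5 2, .const 1 1, .op .mul 4 1 3, .op .lt 2 7 4, .op .sub 2 6 2, .loop 2 powerRound,
    .const 1 8, .op .lt 2 9 1,
    .cond 2 table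
      (block [.const 2 c, .op .mul 10 10 2, .const 1 0, .op .add 11 7 1,
        .loop 11 (groupRound pre qry R)])]

theorem runs_reduction {N d M c R W W' K Tp Tq : ℕ} {A B : Fin N → Fin d → Bool}
    {table pre qry : Prog} (hM : 1 ≤ M) (hN : 1 ≤ N) (hc : 1 ≤ c)
    {r : ℕ} (hr1 : (2 ^ M) ^ r ≤ N) (hr2 : N < (2 ^ M) ^ (r + 1))
    (hWpos : 0 < W) (hWW : 6 * W + 6 < W') (h1 : c * r * 2 ^ r * 3 < W')
    (h2 : 2 * N * d + c * r + 2 * N + 10 < W') (h3 : (N / 2 ^ r + 1) * (N + 1) < W')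
    (h4 : 2 ^ M * N < W') (h5 : d < W') (h6 : c < W')
    (hR : 1 ≤ R) (hpre : RegsLt R pre) (hqry : RegsLt R qry)
    (htable : r < 3 → ∀ s, Runs W' (ovInput A B) table s fun t s' =>
      t ≤ K ∧ (s'.reg 0 ≠ 0 ↔ ∃ i j, Orthogonal (A i) (B j)))
    (h : 3 ≤ r → AnswersGroups W (2 ^ r) (c * r) Tp Tq A B pre qry) :
    Runs W' (ovInput A B) (reduction M c R table pre qry) (State.start fun _ => 0) fun t σ =>
      t ≤ N * 21 + 40 + (if r < 3 then K else
        (N / 2 ^ r + 1) * (110 * Tp + R + N * (100 * Tq + R + 21) + 21)) ∧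
      (σ.reg 0 ≠ 0 ↔ ∃ i j, Orthogonal (A i) (B j)) := by
  have h2M : 2 ≤ 2 ^ M := Nat.le_self_pow (by omega) 2
  have h2N : 2 ^ M ≤ 2 ^ M * N := Nat.le_mul_of_pos_right _ hN
  simp only [reduction, runs_block_cons, runs_block_nil, runs_const, runs_read, runs_op,
    setReg_reg, BinOp.eval, Nat.reduceEqDiff, if_true, if_false, one_mul,
    OfNat.ofNat_ne_one, getD_ovInput_zero, getD_ovInput_one]
  refine ⟨by omega, by omega, by omega, h5, by omega, by omega, by omega, by omega, by omega,
    by omega, by split_ifs <;> omega, by omega, ?_⟩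
  refine (runs_powerLoop (M := M) (N := N) hM hN h4 ?_ ?_ ?_ ?_ ?_ ?_ ?_ ?_).mono ?_
  iterate 8 · simp [setReg_reg]
  rintro t σ ⟨ht, ⟨r', s9, s10, hr1', hr2'⟩, hmem, hreg⟩
  obtain rfl : r = r' := by
    have hlt : 1 < 2 ^ M := h2M
    have := (Nat.pow_lt_pow_iff_right hlt).1 (hr1.trans_lt hr2')
    have := (Nat.pow_lt_pow_iff_right hlt).1 (hr1'.trans_lt hr2)
    omega
  have s0 : σ.reg 0 = 0 := by rw [hreg 0 (by omega)]; simp [setReg_reg, State.start]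
  have s7 : σ.reg 7 = N := by rw [hreg 7 (by omega)]; simp [setReg_reg]
  have s8 : σ.reg 8 = d := by rw [hreg 8 (by omega)]; simp [setReg_reg]
  have s15 : σ.reg 15 = 0 := by rw [hreg 15 (by omega)]; simp [setReg_reg, State.start]
  have s16 : σ.reg 16 = 0 := by rw [hreg 16 (by omega)]; simp [setReg_reg, State.start]
  have smem : σ.mem = fun _ => 0 := by rw [hmem]; rfl
  rw [s9]
  refine ⟨by omega, by split_ifs <;> omega, ?_⟩
  by_cases hr : r < 3
  · have h8 : 2 ^ r < 8 := (Nat.pow_lt_pow_iff_right one_lt_two).2 hr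
    simp only [runs_cond, setReg_reg, h8, hr, if_true, one_ne_zero, if_false]
    refine (htable hr _).mono fun t' s' ⟨ht', hs'⟩ => ⟨?_, hs'⟩
    clear * - ht ht'
    omega
  · have h8 : ¬ 2 ^ r < 8 := by
      rw [show 8 = 2 ^ 3 by rfl, Nat.pow_lt_pow_iff_right one_lt_two]
      exact hr
    have hrN : 2 ^ r ≤ N := (Nat.pow_le_pow_left h2M r).trans hr1
    have hm : 0 < c * r := Nat.mul_pos hc (by omega)
    simp only [runs_cond, runs_block_cons, runs_block_nil, runs_const, runs_op, BinOp.eval,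
      setReg_reg, h8, hr, if_true, if_false, s10, s7, Nat.reduceEqDiff, add_zero,
      OfNat.ofNat_ne_one]
    rw [mul_comm r c]
    refine ⟨h6, by omega, by omega, by omega, ?_⟩
    refine (runs_groupLoop hm (by positivity) hrN hWpos hWW h1 h2 h3 hR hpre hqry (h (by omega))
      ?_ ?_ ?_ ?_ ?_).mono ?_
    · constructor
      · simp [setReg_reg, s7]
      · simp [setReg_reg, s8]
      · simp [setReg_reg, s9]
      · simp [setReg_reg]
      · simp only [setReg_mem, smem]
        intro _
        omega
      · simp [setReg_mem, smem]
      · simp [setReg_mem, smem]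
      · simp [setReg_mem, smem]
    · simp [setReg_reg]
    · simp [setReg_reg, s15]
    · simp [setReg_reg, s16]
    · simp [setReg_reg, s0]
    · rintro t' σ' ⟨ht', hσ'⟩
      refine ⟨?_, hσ'⟩
      clear * - ht ht'
      omega

/-! ### Correctness and running time of the algorithm -/

theorem logSize_two_pow (c r : ℕ) : logSize c (2 ^ r) = c * r := by
  unfold logSize
  rw [Nat.cast_pow, Nat.cast_ofNat, Real.logb_pow, Real.logb_self_eq_one one_lt_two, mul_one,
    ← Nat.cast_mul, Nat.ceil_natCast]

theorem logSize_le_mul {c : ℝ} (hc : 0 ≤ c) {N : ℕ} (hN : 1 ≤ N) :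
    logSize c N ≤ (⌈c⌉₊ + 1) * N := by
  unfold logSize
  have hlog : Real.logb 2 N ≤ N := by
    rw [Real.logb_le_iff_le_rpow one_lt_two (by exact_mod_cast hN), Real.rpow_natCast]
    exact_mod_cast (Nat.lt_two_pow_self (n := N)).le
  refine Nat.ceil_le.2 ?_
  push_cast
  have h1 := Nat.le_ceil c
  have hN' : (1 : ℝ) ≤ N := by exact_mod_cast hN
  nlinarith

/-- Curves with `c * r` vertices have room for the vectors. -/
theorem two_mul_logSize_le {c₀ : ℝ} (hc₀ : 0 ≤ c₀) {N M r : ℕ} (hN : 1 ≤ N) (hr : 1 ≤ r)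
    (hNr : N < (2 ^ M) ^ (r + 1)) :
    2 * logSize c₀ N ≤ 2 * ⌈2 * M * c₀ + 1⌉₊ * r := by
  have hlog : Real.logb 2 N ≤ M * (r + 1) := by
    rw [Real.logb_le_iff_le_rpow one_lt_two (by exact_mod_cast hN)]
    have : (N : ℝ) ≤ ((2 ^ M) ^ (r + 1) : ℕ) := by exact_mod_cast hNr.le
    refine this.trans_eq ?_
    push_cast
    rw [← pow_mul, ← Real.rpow_natCast]
    push_cast
    rfl
  have hr' : (1 : ℝ) ≤ r := by exact_mod_cast hr
  have hM' : (0 : ℝ) ≤ M := Nat.cast_nonneg M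
  have h1 : c₀ * Real.logb 2 N ≤ c₀ * (2 * M * r) :=
    mul_le_mul_of_nonneg_left (hlog.trans (by nlinarith)) hc₀
  have h2 := Nat.le_ceil (2 * M * c₀ + 1)
  have h3 : logSize c₀ N ≤ ⌈2 * M * c₀ + 1⌉₊ * r := by
    refine Nat.ceil_le.2 ?_
    push_cast
    nlinarith
  calc 2 * logSize c₀ N ≤ 2 * (⌈2 * M * c₀ + 1⌉₊ * r) := Nat.mul_le_mul_left 2 h3
    _ = _ := by ring

/-- Small instances are solved in constant time. -/
theorem exists_table_ovInput (N₀ d₀ : ℕ) :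
    ∃ (p : Prog) (K V : ℕ), ∀ (W N d : ℕ) (A B : Fin N → Fin d → Bool) (s : State),
      N ≤ N₀ → d ≤ d₀ → V < W → Runs W (ovInput A B) p s fun t s' =>
        t ≤ K ∧ (s'.reg 0 ≠ 0 ↔ ∃ i j, Orthogonal (A i) (B j)) := by
  obtain ⟨p, K, h⟩ := exists_table (N₀ + d₀ + 2) (2 * N₀ * d₀ + 2) fun f =>
    ∃ i < f 0, ∃ j < f 0, ∀ k < f 1, f (i * f 1 + k + 2) = 0 ∨ f ((f 0 + j) * f 1 + k + 2) = 0
  refine ⟨p, K, N₀ + d₀ + 2 + (2 * N₀ * d₀ + 2) + 1, fun W N d A B s hN hd hW => ?_⟩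
  have hV : ∀ i, (ovInput A B).getD i 0 < N₀ + d₀ + 2 := by
    intro i
    have := getD_ovInput_le A B i
    omega
  refine (h W _ s hW hV).mono fun t s' ⟨ht, hs⟩ => ⟨ht, hs.trans ?_⟩
  have hpos : ∀ i < 2 * N, ∀ k < d, i * d + k + 2 < 2 * N₀ * d₀ + 2 := by
    intro i hi k hk
    have h1 : (i + 1) * d ≤ 2 * N₀ * d₀ := Nat.mul_le_mul (by omega) hd
    rw [Nat.succ_mul] at h1
    omega
  simp only [show 0 < 2 * N₀ * d₀ + 2 by omega, show 1 < 2 * N₀ * d₀ + 2 by omega, if_true,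
    getD_ovInput_zero, getD_ovInput_one]
  constructor
  · rintro ⟨i, hi, j, hj, hij⟩
    refine ⟨⟨i, hi⟩, ⟨j, hj⟩, (orthogonal_iff _ _).2 fun k => ?_⟩
    by_cases hk : k < d
    · have := hij k hk
      rwa [if_pos (hpos i (by omega) k hk), if_pos (hpos _ (by omega) k hk),
        getD_ovInput_left A B ⟨i, hi⟩ hk, getD_ovInput_right A B ⟨j, hj⟩ hk] at this
    · simp [bits, hk]
  · rintro ⟨i, j, hij⟩
    have hi := i.2
    have hj := j.2
    refine ⟨i, hi, j, hj, fun k hk => ?_⟩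
    rw [if_pos (hpos i (by omega) k hk), if_pos (hpos _ (by omega) k hk),
      getD_ovInput_left A B i hk, getD_ovInput_right A B j hk]
    exact (orthogonal_iff _ _).1 hij k

/-- The data structure applied to the gadget curves of a group of vectors. -/
theorem answersGroups_of_ann {N d n m D C : ℕ} {γ Tp Tq : ℝ} {A B : Fin N → Fin d → Bool}
    {pre qry : Prog} (hγ : γ < 3) (hD : 1 ≤ D) (hn : 8 ≤ n) (hm : 2 ≤ m) (hd : 2 * d ≤ m)
    (hA : Function.Injective A)
    (h : ∀ (δ : ℚ) (P : Fin n → Fin m → ℚ), 0 < δ → RatBounded ((n * m) ^ D) δ →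
      Function.Injective P → (∀ i j, RatBounded ((n * m) ^ D) (P i j)) →
      ∃ (t : ℕ) (s : State),
        Exec ((n + 2) ^ C) (annInput m δ P) pre (State.start fun _ => 0) t s ∧
        (t : ℝ) ≤ Tp ∧
        ∀ Q : Fin m → ℚ, (∀ j, RatBounded ((n * m) ^ D) (Q j)) →
          ∃ (t' : ℕ) (s' : State) (ans : Option (Fin n)),
            Exec ((n + 2) ^ C) (encodeCurve Q) qry (State.start s.mem) t' s' ∧
            (t' : ℝ) ≤ Tq ∧ s'.reg 0 = encodeAnswer ans ∧ CorrectAnswer γ (δ : ℝ) P Q ans) :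
    AnswersGroups ((n + 2) ^ C) n m ⌊Tp⌋₊ ⌊Tq⌋₊ A B pre qry := by
  intro st hst
  have hB : m + 6 ≤ (n * m) ^ D := by
    have h1 : m + 6 ≤ n * m := by nlinarith
    exact h1.trans (Nat.le_self_pow (by omega) _)
  have hinj : Function.Injective fun i : Fin n =>
      gadgetCurve 3 1 m (bits (A ⟨st + i, by omega⟩)) := by
    intro i j hij
    have := hA (gadgetCurve_bits_injective hd hij)
    simp only [Fin.mk.injEq, Nat.add_left_cancel_iff] at this
    exact Fin.ext this
  obtain ⟨t, s, he, ht, hq⟩ := h 1 _ one_pos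
    ⟨by simp only [Rat.num_one, Int.natAbs_one]; omega, by simp only [Rat.den_one]; omega⟩ hinj
    fun i j => gadgetCurve_ratBounded (by omega) (by omega) hB _ j
  refine ⟨t, s, he, Nat.le_floor ht, fun b => ?_⟩
  obtain ⟨t', s', ans, he', ht', hans, hcorrect⟩ := hq (gadgetCurve 0 2 m (bits (B b)))
    fun j => gadgetCurve_ratBounded (by omega) (by omega) hB _ j
  refine ⟨t', s', he', Nat.le_floor ht', ?_⟩
  rw [Rat.cast_one] at hcorrect
  rw [← CorrectAnswer.ne_none_iff (A := fun i : Fin n => A ⟨st + i, by omega⟩) hγ (by omega) hd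
    hcorrect, hans]
  cases ans <;> simp [encodeAnswer]

/-- The time for all groups of size `n = 2 ^ r`, where the data structure needs `Tp` steps for the
preprocessing and `Tq` for a query. Each of the at most `2 * N / n` groups costs
`O(N * n ^ (1 - η))` steps, and `n ^ (-η)` is at most `2 * N ^ (-η / M)`. -/
theorem reduction_time_le {N M r : ℕ} {η Tp Tq R K : ℝ} (hM : 1 ≤ M) (hη : 0 < η) (hη1 : η ≤ 1)
    (hN : 1 ≤ N) (hr1 : (2 ^ M) ^ r ≤ N) (hr2 : N < (2 ^ M) ^ (r + 1)) (hR : 0 ≤ R) (hK : 0 ≤ K)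
    (hTp : Tp ≤ K * (2 ^ r : ℝ) ^ (M : ℝ)) (hTq : Tq ≤ K * (2 ^ r : ℝ) ^ (1 - η)) :
    ((N : ℝ) / 2 ^ r + 1) * (110 * Tp + R + N * (100 * Tq + R + 21) + 21) ≤
      (840 * K + 8 * R + 168) * (N : ℝ) ^ (2 - η / M) := by
  set n : ℝ := 2 ^ r with hn
  have hn1 : 1 ≤ n := one_le_pow₀ one_le_two
  have hn0 : 0 < n := by linarith
  have hN1 : (1 : ℝ) ≤ N := by exact_mod_cast hN
  have hN0 : (0 : ℝ) < N := by linarith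
  have hM1 : (1 : ℝ) ≤ M := by exact_mod_cast hM
  have hM0 : (0 : ℝ) < M := by linarith
  have hnM : n ^ (M : ℝ) ≤ N := by
    rw [Real.rpow_natCast, hn, ← pow_mul, mul_comm, pow_mul]
    exact_mod_cast hr1
  have hnN : n ≤ N := (Real.self_le_rpow_of_one_le hn1 hM1).trans hnM
  have hNn : (N : ℝ) ≤ (2 * n) ^ (M : ℝ) := by
    have : (N : ℝ) ≤ ((2 ^ M) ^ (r + 1) : ℕ) := by exact_mod_cast hr2.le
    refine this.trans_eq ?_
    rw [Real.rpow_natCast, hn]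
    push_cast
    rw [← pow_succ', ← pow_mul, ← pow_mul, mul_comm]
  set X : ℝ := n ^ (1 - η) with hX
  have hX1 : 1 ≤ X := Real.one_le_rpow hn1 (by linarith)
  have hNX : (N : ℝ) ≤ N * X := le_mul_of_one_le_right hN0.le hX1
  have hNX1 : 1 ≤ N * X := hN1.trans hNX
  -- the queries dominate the time for a group
  have hround : 110 * Tp + R + N * (100 * Tq + R + 21) + 21 ≤
      (210 * K + 2 * R + 42) * (N * X) := by
    have e1 : Tp ≤ K * (N * X) := hTp.trans (mul_le_mul_of_nonneg_left (hnM.trans hNX) hK)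
    have e2 : N * Tq ≤ K * (N * X) := by
      calc N * Tq ≤ N * (K * X) := mul_le_mul_of_nonneg_left hTq hN0.le
        _ = _ := by ring
    have e3 : R ≤ R * (N * X) := le_mul_of_one_le_right hR hNX1
    have e4 : N * R ≤ R * (N * X) := by
      rw [mul_comm]
      exact mul_le_mul_of_nonneg_left hNX hR
    nlinarith
  have hgroups : (N : ℝ) / n + 1 ≤ 2 * (N / n) := by
    have : 1 ≤ N / n := (one_le_div hn0).2 hnN
    linarith
  have hsave : X / n ≤ 2 * (N : ℝ) ^ (-(η / M)) := by
    have e1 : X / n = n ^ (-η) := by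
      rw [hX, ← Real.rpow_sub_one hn0.ne']
      congr 1
      ring
    have e2 : n ^ (-η) = 2 ^ η * (2 * n) ^ (-η) := by
      rw [Real.mul_rpow zero_le_two hn0.le, ← mul_assoc, ← Real.rpow_add two_pos, add_neg_cancel,
        Real.rpow_zero, one_mul]
    have e3 : (2 : ℝ) ^ η ≤ 2 := by
      simpa using Real.rpow_le_rpow_of_exponent_le one_le_two hη1
    have e4 : (2 * n) ^ (-η) ≤ (N : ℝ) ^ (-(η / M)) := by
      have : (2 * n) ^ (-η) = ((2 * n) ^ (M : ℝ)) ^ (-(η / M)) := by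
        rw [← Real.rpow_mul (by positivity)]
        congr 1
        field_simp
      rw [this]
      refine Real.rpow_le_rpow_of_nonpos hN0 hNn ?_
      have : 0 < η / M := div_pos hη hM0
      linarith
    rw [e1, e2]
    exact mul_le_mul e3 e4 (by positivity) zero_le_two
  have hpow : (N : ℝ) ^ (2 - η / M) = N * N * (N : ℝ) ^ (-(η / M)) := by
    rw [sub_eq_add_neg, Real.rpow_add hN0, Real.rpow_two, sq]
  have hX0 : 0 < X := by linarith
  have hc : 0 ≤ 210 * K + 2 * R + 42 := by linarith
  calc ((N : ℝ) / n + 1) * (110 * Tp + R + N * (100 * Tq + R + 21) + 21)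
      ≤ (N / n + 1) * ((210 * K + 2 * R + 42) * (N * X)) :=
        mul_le_mul_of_nonneg_left hround (by positivity)
    _ ≤ (2 * (N / n)) * ((210 * K + 2 * R + 42) * (N * X)) :=
        mul_le_mul_of_nonneg_right hgroups (by positivity)
    _ = 2 * (210 * K + 2 * R + 42) * (N * N) * (X / n) := by
        field_simp
    _ ≤ 2 * (210 * K + 2 * R + 42) * (N * N) * (2 * (N : ℝ) ^ (-(η / M))) :=
        mul_le_mul_of_nonneg_left hsave (by positivity)
    _ = _ := by
        rw [hpow]
        ring

/-- The running time of `reduction`, including the search for `r` and small instances. -/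
theorem total_time_le {N M r R K K' t : ℕ} {η β ε' : ℝ} (hM : 1 ≤ M) (hη : 0 < η) (hη1 : η ≤ 1)
    (hN : 1 ≤ N) (hr1 : (2 ^ M) ^ r ≤ N) (hr2 : N < (2 ^ M) ^ (r + 1)) (hβ : β ≤ M) (hηε : η ≤ ε')
    (ht : t ≤ N * 21 + 40 + if r < 3 then K' else
      (N / 2 ^ r + 1) * (110 * ⌊K * ((2 ^ r : ℕ) : ℝ) ^ β⌋₊ + R +
        N * (100 * ⌊K * ((2 ^ r : ℕ) : ℝ) ^ (1 - ε')⌋₊ + R + 21) + 21)) :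
    (t : ℝ) ≤ (840 * K + 8 * R + 168 + 61 + K' : ℕ) * (N : ℝ) ^ (2 - η / M) := by
  have hN1 : (1 : ℝ) ≤ N := by exact_mod_cast hN
  have hM1 : (1 : ℝ) ≤ M := by exact_mod_cast hM
  have hNe : (N : ℝ) ≤ (N : ℝ) ^ (2 - η / M) := by
    refine Real.self_le_rpow_of_one_le hN1 ?_
    have : η / M ≤ 1 := (div_le_one (by linarith)).2 (hη1.trans hM1)
    linarith
  have ht' : (t : ℝ) ≤ N * 21 + 40 + ((if r < 3 then K' else
      (N / 2 ^ r + 1) * (110 * ⌊K * ((2 ^ r : ℕ) : ℝ) ^ β⌋₊ + R +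
        N * (100 * ⌊K * ((2 ^ r : ℕ) : ℝ) ^ (1 - ε')⌋₊ + R + 21) + 21) : ℕ) : ℝ) := by
    exact_mod_cast ht
  refine ht'.trans ?_
  set E := (N : ℝ) ^ (2 - η / M) with hE
  have hE1 : 1 ≤ E := hN1.trans hNe
  have hK'0 : (0 : ℝ) ≤ K' := Nat.cast_nonneg _
  have hK0 : (0 : ℝ) ≤ K := Nat.cast_nonneg _
  have hR0 : (0 : ℝ) ≤ R := Nat.cast_nonneg _
  push_cast
  split_ifs with hr3
  · nlinarith
  · have hn1 : (1 : ℝ) ≤ 2 ^ r := one_le_pow₀ one_le_two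
    have htime := reduction_time_le (R := R) (K := K)
      (Tp := ⌊K * ((2 ^ r : ℕ) : ℝ) ^ β⌋₊) (Tq := ⌊K * ((2 ^ r : ℕ) : ℝ) ^ (1 - ε')⌋₊)
      hM hη hη1 hN hr1 hr2 hR0 hK0 ?_ ?_
    · have hdiv : ((N / 2 ^ r : ℕ) : ℝ) ≤ (N : ℝ) / 2 ^ r := by
        refine Nat.cast_div_le.trans_eq ?_
        push_cast
        rfl
      have hle := mul_le_mul_of_nonneg_right (add_le_add_left hdiv 1)
        (b := (N / 2 ^ r : ℕ) + 1) (c := (N : ℝ) / 2 ^ r + 1)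
        (a := 110 * (⌊K * ((2 ^ r : ℕ) : ℝ) ^ β⌋₊ : ℝ) + R +
        N * (100 * (⌊K * ((2 ^ r : ℕ) : ℝ) ^ (1 - ε')⌋₊ : ℝ) + R + 21) + 21) (by positivity)
      push_cast at hle htime ⊢
      nlinarith
    · refine (Nat.floor_le (by positivity)).trans ?_
      push_cast
      exact mul_le_mul_of_nonneg_left (Real.rpow_le_rpow_of_exponent_le hn1 hβ) hK0
    · refine (Nat.floor_le (by positivity)).trans ?_
      push_cast
      exact mul_le_mul_of_nonneg_left
        (Real.rpow_le_rpow_of_exponent_le hn1 (by linarith)) hK0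

/-- The word bound `(N + 2) ^ (C + 3 + b)` leaves room for addressing the simulated memory and for
numbers quadratic in `N`. -/
theorem word_bound {N C b x : ℕ} (hb20 : 20 ≤ b) (hx : x ≤ N) :
    6 * (x + 2) ^ C + 6 < (N + 2) ^ (C + 3 + b) ∧
      ∀ a, a ≤ b * (N + 2) ^ 2 → a < (N + 2) ^ (C + 3 + b) := by
  have hW3 : (N + 2) ^ C * ((N + 2) ^ 3 * 2 ^ b) ≤ (N + 2) ^ (C + 3 + b) := by
    rw [pow_add, pow_add, mul_assoc]
    exact Nat.mul_le_mul_left _ (Nat.mul_le_mul_left _ (Nat.pow_le_pow_left (by omega) b))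
  have hb2 : b < 2 ^ b := Nat.lt_two_pow_self
  have hY : 1 ≤ (N + 2) ^ C := Nat.one_le_pow _ _ (by omega)
  refine ⟨?_, ?_⟩
  · have e1 : (x + 2) ^ C ≤ (N + 2) ^ C := Nat.pow_le_pow_left (by omega) C
    have e2 : 20 ≤ (N + 2) ^ 3 * 2 ^ b := by
      have : 1 ≤ (N + 2) ^ 3 := Nat.one_le_pow _ _ (by omega)
      nlinarith
    nlinarith
  · intro a ha
    have e1 : b * (N + 2) ^ 2 < 2 ^ b * (N + 2) ^ 2 :=
      Nat.mul_lt_mul_of_pos_right hb2 (by positivity)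
    have e2 : (N + 2) ^ 2 ≤ (N + 2) ^ 3 := Nat.pow_le_pow_right (by omega) (by omega)
    have e3 : 2 ^ b * (N + 2) ^ 2 ≤ (N + 2) ^ 3 * 2 ^ b := by
      rw [mul_comm]
      exact Nat.mul_le_mul_right _ e2
    have e4 := Nat.le_mul_of_pos_left ((N + 2) ^ 3 * 2 ^ b) hY
    omega

theorem word_sizes {N M r c d d₁ V b : ℕ} (hb : b = V + 3 * c + 2 * d₁ + 2 ^ M + 20)
    (hrN : 2 ^ r ≤ N) (hrN' : r ≤ N) (hdN : d ≤ d₁ * N) :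
    c * r * 2 ^ r * 3 ≤ b * (N + 2) ^ 2 ∧ 2 * N * d + c * r + 2 * N + 10 ≤ b * (N + 2) ^ 2 ∧
      (N / 2 ^ r + 1) * (N + 1) ≤ b * (N + 2) ^ 2 ∧ 2 ^ M * N ≤ b * (N + 2) ^ 2 ∧
      d ≤ b * (N + 2) ^ 2 ∧ c ≤ b * (N + 2) ^ 2 ∧ V ≤ b * (N + 2) ^ 2 := by
  have hsq : N * N + 4 * N + 4 = (N + 2) ^ 2 := by ring
  have hbmul : b * (N + 2) ^ 2 = V * (N + 2) ^ 2 + c * (3 * (N + 2) ^ 2) +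
      d₁ * (2 * (N + 2) ^ 2) + 2 ^ M * (N + 2) ^ 2 + 20 * (N + 2) ^ 2 := by
    rw [hb]
    ring
  have hcr : c * r ≤ c * N := Nat.mul_le_mul_left c hrN'
  have hcN : c * N ≤ c * (3 * (N + 2) ^ 2) := Nat.mul_le_mul_left c (by omega)
  have w1 : c * r * 2 ^ r * 3 ≤ b * (N + 2) ^ 2 := by
    have : c * r * 2 ^ r * 3 ≤ c * (3 * (N + 2) ^ 2) := by
      calc c * r * 2 ^ r * 3 ≤ c * N * N * 3 := by gcongr
        _ = c * (3 * (N * N)) := by ring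
        _ ≤ _ := Nat.mul_le_mul_left c (by omega)
    omega
  have w2 : 2 * N * d + c * r + 2 * N + 10 ≤ b * (N + 2) ^ 2 := by
    have : 2 * N * d ≤ d₁ * (2 * (N + 2) ^ 2) := by
      calc 2 * N * d ≤ 2 * N * (d₁ * N) := Nat.mul_le_mul_left _ hdN
        _ = d₁ * (2 * (N * N)) := by ring
        _ ≤ _ := Nat.mul_le_mul_left d₁ (by omega)
    omega
  have w3 : (N / 2 ^ r + 1) * (N + 1) ≤ b * (N + 2) ^ 2 := by
    have : (N / 2 ^ r + 1) * (N + 1) ≤ (N + 2) ^ 2 := by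
      have e := Nat.div_le_self N (2 ^ r)
      calc (N / 2 ^ r + 1) * (N + 1) ≤ (N + 2) * (N + 2) := Nat.mul_le_mul (by omega) (by omega)
        _ = _ := by ring
    omega
  have w4 : 2 ^ M * N ≤ b * (N + 2) ^ 2 := by
    have : 2 ^ M * N ≤ 2 ^ M * (N + 2) ^ 2 := Nat.mul_le_mul_left _ (by omega)
    omega
  have w5 : d ≤ b * (N + 2) ^ 2 := by
    have : d₁ * N ≤ d₁ * (2 * (N + 2) ^ 2) := Nat.mul_le_mul_left _ (by omega)
    omega
  have w6 : c ≤ b * (N + 2) ^ 2 := by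
    have : c * 1 ≤ c * (3 * (N + 2) ^ 2) := Nat.mul_le_mul_left _ (by omega)
    omega
  have w7 : V ≤ b * (N + 2) ^ 2 := by
    have : V * 1 ≤ V * (N + 2) ^ 2 := Nat.mul_le_mul_left _ (by omega)
    omega
  exact ⟨w1, w2, w3, w4, w5, w6, w7⟩

/-- A near neighbor data structure with approximation factor below `3` yields an algorithm for
orthogonal vectors in subquadratic time. -/
theorem exists_solvesOV {γ β ε' η c₀ : ℝ} {M D : ℕ} (hγ : γ < 3) (hM : 1 ≤ M) (hβ : β ≤ M)
    (hη : 0 < η) (hη1 : η ≤ 1) (hηε : η ≤ ε') (hc₀ : 0 < c₀) (hD : 1 ≤ D)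
    (h : HasANN γ (logSize ((2 * ⌈2 * M * c₀ + 1⌉₊ : ℕ) : ℝ))
      (logSize ((2 * ⌈2 * M * c₀ + 1⌉₊ : ℕ) : ℝ)) D
      (fun n => (n : ℝ) ^ β) (fun n => (n : ℝ) ^ (1 - ε'))) :
    ∃ p, SolvesOV c₀ (2 - η / M) p := by
  obtain ⟨pre, qry, C, K, hann⟩ := h
  obtain ⟨R₁, hR₁⟩ := exists_regsLt pre
  obtain ⟨R₂, hR₂⟩ := exists_regsLt qry
  have hc : 1 ≤ 2 * ⌈2 * M * c₀ + 1⌉₊ := by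
    have : 0 < ⌈2 * M * c₀ + 1⌉₊ := Nat.ceil_pos.2 (by positivity)
    omega
  obtain ⟨c, hc_def⟩ : ∃ c, c = 2 * ⌈2 * M * c₀ + 1⌉₊ := ⟨_, rfl⟩
  obtain ⟨R, hR⟩ : ∃ R, R = R₁ + R₂ + 1 := ⟨_, rfl⟩
  obtain ⟨d₁, hd₁⟩ : ∃ d₁, d₁ = ⌈c₀⌉₊ + 1 := ⟨_, rfl⟩
  rw [← hc_def] at hc hann
  obtain ⟨table, K', V, htable⟩ := exists_table_ovInput ((2 ^ M) ^ 3) (d₁ * (2 ^ M) ^ 3)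
  -- apart from the simulated memory, all words and addresses are at most `b * (N + 2) ^ 2`
  obtain ⟨b, hb⟩ : ∃ b, b = V + 3 * c + 2 * d₁ + 2 ^ M + 20 := ⟨_, rfl⟩
  refine ⟨reduction M c R table pre qry, C + 3 + b, 840 * K + 8 * R + 168 + 61 + K', ?_⟩
  intro N d hN hd A B hA _
  obtain ⟨r, hr1, hr2⟩ : ∃ r, (2 ^ M) ^ r ≤ N ∧ N < (2 ^ M) ^ (r + 1) :=
    ⟨Nat.log (2 ^ M) N, Nat.pow_log_le_self _ (by omega),
      Nat.lt_pow_succ_log_self (Nat.one_lt_two_pow (by omega)) N⟩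
  have h2M : 2 ≤ 2 ^ M := Nat.le_self_pow (by omega) 2
  have hrN : 2 ^ r ≤ N := (Nat.pow_le_pow_left h2M r).trans hr1
  have hrN' : r < N := Nat.lt_two_pow_self.trans_le hrN
  have hdN : d ≤ d₁ * N := hd₁ ▸ hd.trans_le (logSize_le_mul hc₀.le hN)
  obtain ⟨hWW, hsmall⟩ := word_bound (N := N) (C := C) (b := b) (x := 2 ^ r) (by omega) hrN
  obtain ⟨w1, w2, w3, w4, w5, w6, w7⟩ := word_sizes hb hrN hrN'.le hdN
  have htab : r < 3 → ∀ s, Runs ((N + 2) ^ (C + 3 + b)) (ovInput A B) table s fun t s' =>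
      t ≤ K' ∧ (s'.reg 0 ≠ 0 ↔ ∃ i j, Orthogonal (A i) (B j)) := by
    intro hr3 s
    have hN3 : N ≤ (2 ^ M) ^ 3 :=
      hr2.le.trans (Nat.pow_le_pow_right (by positivity) (by omega))
    exact htable _ N d A B s hN3 (hdN.trans (Nat.mul_le_mul_left _ hN3)) (hsmall _ w7)
  have hgroups : 3 ≤ r → AnswersGroups ((2 ^ r + 2) ^ C) (2 ^ r) (c * r)
      ⌊K * ((2 ^ r : ℕ) : ℝ) ^ β⌋₊ ⌊K * ((2 ^ r : ℕ) : ℝ) ^ (1 - ε')⌋₊ A B pre qry := by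
    intro hr3
    have h8 : 8 ≤ 2 ^ r := Nat.pow_le_pow_right (n := 2) (by omega) hr3
    have hcr2 : 2 ≤ c * r := by nlinarith
    have hspec := hann (2 ^ r) (by omega)
    rw [logSize_two_pow] at hspec
    have hd2 : 2 * d ≤ c * r := by
      rw [hd, hc_def]
      exact two_mul_logSize_le hc₀.le hN (by omega) hr2
    exact answersGroups_of_ann hγ hD h8 hcr2 hd2 hA (hspec hcr2 le_rfl)
  obtain ⟨t, s, he, ht, hs⟩ := runs_reduction hM hN hc hr1 hr2 (by positivity) hWW
    (hsmall _ w1) (hsmall _ w2) (hsmall _ w3) (hsmall _ w4) (hsmall _ w5) (hsmall _ w6)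
    (by omega : 1 ≤ R) (hR₁.mono (by omega)) (hR₂.mono (by omega)) htab hgroups
  exact ⟨t, s, he, total_time_le hM hη hη1 hN hr1 hr2 hβ hηε ht, hs⟩

end FrechetANN

theorem theorem7 (hOVH : FrechetANN.OVH) (ε ε' β : ℝ) (hε : 0 < ε) (hε2 : ε < 2)
    (hε' : 0 < ε') (hβ : 0 < β) :
    ∃ c : ℝ, 0 < c ∧ ∀ D : ℕ, 1 ≤ D →
      ¬ FrechetANN.HasANN (3 - ε) (FrechetANN.logSize c) (FrechetANN.logSize c) D
          (fun n => (n : ℝ) ^ β) (fun n => (n : ℝ) ^ (1 - ε')) := by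
  have hM : 1 ≤ ⌈β⌉₊ := Nat.ceil_pos.2 hβ
  have hη : 0 < min ε' 1 := lt_min hε' one_pos
  obtain ⟨c₀, hc₀, hno⟩ := hOVH (min ε' 1 / ⌈β⌉₊) (div_pos hη (by exact_mod_cast hM))
  refine ⟨(2 * ⌈2 * ⌈β⌉₊ * c₀ + 1⌉₊ : ℕ), ?_, fun D hD hann => hno ?_⟩
  · have : 0 < ⌈2 * ⌈β⌉₊ * c₀ + 1⌉₊ := Nat.ceil_pos.2 (by positivity)
    exact_mod_cast (by omega : 0 < 2 * ⌈2 * ⌈β⌉₊ * c₀ + 1⌉₊)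
  · exact FrechetANN.exists_solvesOV (by linarith) hM (Nat.le_ceil β) hη (min_le_right _ _)
      (min_le_left _ _) hc₀ hD hann
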